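/- **Setting.** Let $\mathcal H=\bigoplus_{n\ge 0}\mathcal H_n$ be a connected graded commutative Hopf algebra over $\mathbb C$ (so $\mathcal H_0=\mathbb C 1$) with coproduct $\Delta$, counit $\varepsilon$ and antipode $S$, and let $Y(x)=nx$ for $x\in\mathcal H_n$. Let $\mathcal A=\mathcal A_-\oplus\mathcal A_+$ be the algebra of formal Laurent series in $\lambda$ over $\mathbb C$, where $\mathcal A_+=\mathbb C[[\lambda]]$ and $\mathcal A_-=\lambda^{-1}\mathbb C[\lambda^{-1}]$, with projections $P_\pm$; put $R=P_+-P_-$. Let $G_{\mathcal A}$ be the group of unital algebra morphisms $\mathcal H\to\mathcal A$ (characters) under the convolution product $\star$, with unit $\varepsilon$ and inverse $\varphi^{-1}=\varphi\circ S$. For $B=\mathbb C$ or $B=\mathcal A$ let $\mathfrak g_B$ be the Lie algebra of linear maps $Z:\mathcal H\to B$ with $Z(xy)=Z(x)\varepsilon(y)+\varepsilon(x)Z(y)$ and bracket $[Z,Z']=Z\star Z'-Z'\star Z$; thus $\mathfrak g_{\mathbb C}\subset\mathfrak g_{\mathcal A}$. Put $\mathrm{Ad}(g)Z=g\star Z\star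 g^{-1}$. Each $g\in G_{\mathcal A}$ has a unique Birkhoff decomposition $g=g_-^{-1}\star g_+$ with $g_\pm\in G_{\mathcal A}$, $g_+(\mathcal H)\subset\mathcal A_+$ and $g_-(\ker\varepsilon)\subset\mathcal A_-$. For $\varphi\in G_{\mathcal A}$ and $s\in\mathbb C$ let $\varphi^s(x)=e^{s\lambda n}\varphi(x)$ for $x\in\mathcal H_n$; $\varphi$ is *local* if $(\varphi^s)_-$ does not depend on $s$. Its $\beta$-function is $\beta_\varphi=-\mathrm{Res}(\varphi_-)\circ Y\in\mathfrak g_{\mathbb C}$, where $\mathrm{Res}$ takes the coefficient of $\lambda^{-1}$. Put $\tilde R(\varphi)=\varphi^{-1}\star(\varphi\circ Y)$; the map $\lambda\tilde R:\varphi\mapsto\lambda\,\tilde R(\varphi)$ is a bijection $G_{\mathcal A}\to\mathfrak g_{\mathcal A}$. **Theorem.** Let $\varphi\in G_{\mathcal A}$ be local, and let $f:\mathfrak g_{\mathcal A}\to\mathfrak g_{\mathcal A}$ be $\mathrm{Ad}$-covariant, i.e. $\mathrm{Ad}(g)f(L)=f(\mathrm{Ad}(g)L)$ for all $g\in G_{\mathcal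 A}$, $L\in\mathfrak g_{\mathcal A}$, with $[f(\beta_\varphi),\beta_\varphi]=0$. Consider the Lax pair equation $$\frac{dL}{dt}=[L,M],\qquad M=\tfrac12R(f(L)),\qquad L(0)=\beta_\varphi,\qquad t\in\mathbb R,$$ where derivatives are taken for each coefficient of each $L(t)(x)$. It has the solution $L(t)=\mathrm{Ad}(g_+(t))\beta_\varphi=\mathrm{Ad}(g_-(t))\beta_\varphi$, where $\exp(-tf(\beta_\varphi))=g_-(t)^{-1}\star g_+(t)$ is the Birkhoff decomposition. For this solution, and for every other solution $L:\mathbb R\to\mathfrak g_{\mathcal A}$, each $L(t)$ takes values in $\mathcal A_+$, so that $L(t)|_{\lambda=0}\in\mathfrak g_{\mathbb C}$ is defined, and the characters $$\xi_t=(\lambda\tilde R)^{-1}\bigl(L(t)|_{\lambda=0}\bigr)$$ satisfy, for all $t\in\mathbb R$, 1. $\xi_t$ is local; 2. $\beta_{\xi_t}=L(t)|_{\lambda=0}$; 3. $\xi_0=(\varphi_-)^{-1}$. -/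

import Mathlib

open scoped TensorProduct DirectSum
open WithConv Coalgebra

noncomputable section

namespace LaxBeta

/-! ### Connected graded Hopf algebras -/

/-- `𝓗` makes `H` a connected graded Hopf algebra: besides the algebra grading (the instance
`GradedAlgebra 𝓗`), `H₀ = ℂ · 1`, `ε` vanishes in positive degree, and
`Δ(Hₙ) ⊆ ∑_{i+j=n} Hᵢ ⊗ Hⱼ`.  (The antipode then preserves the grading automatically.) -/
class IsConnectedGraded {H : Type*} [CommRing H] [HopfAlgebra ℂ H]
    (𝓗 : ℕ → Submodule ℂ H) [GradedAlgebra 𝓗] : Prop where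
  zero_eq : 𝓗 0 = Submodule.span ℂ {(1 : H)}
  counit_eq_zero : ∀ n, 0 < n → ∀ x ∈ 𝓗 n, counit (R := ℂ) x = 0
  comul_mem : ∀ n, ∀ x ∈ 𝓗 n, comul (R := ℂ) x ∈
    ⨆ p ∈ Finset.HasAntidiagonal.antidiagonal n,
      LinearMap.range (TensorProduct.map (𝓗 p.1).subtype (𝓗 p.2).subtype)

/-- The degree derivation `Y`, with `Y x = n x` for `x ∈ Hₙ`. -/
def degOp {H : Type*} [CommRing H] [HopfAlgebra ℂ H]
    (𝓗 : ℕ → Submodule ℂ H) [GradedAlgebra 𝓗] : H →ₗ[ℂ] H :=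
  DirectSum.toModule ℂ ℕ H (fun n => (n : ℂ) • (𝓗 n).subtype) ∘ₗ
    (DirectSum.decomposeLinearEquiv 𝓗).toLinearMap

/-! ### Formal Laurent series -/

/-- The algebra `𝒜` of formal Laurent series `∑_{n ≥ -N} aₙ λⁿ`.  (A definition rather than an
abbreviation, so that the scalar multiplication by `ℂ` is always the coefficientwise one.) -/
def Laurent : Type := LaurentSeries ℂ

instance : CommRing Laurent := inferInstanceAs (CommRing (LaurentSeries ℂ))

/-- The coefficientwise `ℂ`-algebra structure. -/
instance : Algebra ℂ Laurent := (HahnSeries.instAlgebra : Algebra ℂ (HahnSeries ℤ ℂ))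

/-- The coefficient of `λⁿ`. -/
def Laurent.coeff (a : Laurent) (n : ℤ) : ℂ := HahnSeries.coeff a n

@[ext] theorem Laurent.ext {a b : Laurent} (h : ∀ n, a.coeff n = b.coeff n) : a = b :=
  HahnSeries.ext (funext h)

@[simp] theorem Laurent.coeff_zero (n : ℤ) : (0 : Laurent).coeff n = 0 := rfl

@[simp] theorem Laurent.coeff_add (a b : Laurent) (n : ℤ) :
    (a + b).coeff n = a.coeff n + b.coeff n := rfl

@[simp] theorem Laurent.coeff_smul (c : ℂ) (a : Laurent) (n : ℤ) :
    (c • a).coeff n = c * a.coeff n := rfl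

theorem Laurent.coeff_algebraMap (c : ℂ) (n : ℤ) :
    (algebraMap ℂ Laurent c).coeff n = if n = 0 then c else 0 := by
  have h : (1 : Laurent).coeff n = if n = 0 then 1 else 0 := by
    refine (HahnSeries.coeff_one (R := ℂ) (Γ := ℤ)).trans ?_
    congr
  rw [Algebra.algebraMap_eq_smul_one, Laurent.coeff_smul, h, mul_ite, mul_one, mul_zero]

/-- The coefficient of `λⁿ`, as a linear map. -/
def coeffL (n : ℤ) : Laurent →ₗ[ℂ] ℂ where
  toFun a := a.coeff n
  map_add' _ _ := rfl
  map_smul' _ _ := rfl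

/-- The variable `λ`. -/
def lam : Laurent := (HahnSeries.single 1 1 : LaurentSeries ℂ)

/-- `a ∈ 𝒜₊`: no negative powers of `λ`. -/
def IsHolo (a : Laurent) : Prop := ∀ n : ℤ, n < 0 → a.coeff n = 0

/-- `a ∈ 𝒜₋ = λ⁻¹ ℂ[λ⁻¹]`: a polynomial in `λ⁻¹` without constant term. -/
def IsPolar (a : Laurent) : Prop := ∀ n : ℤ, 0 ≤ n → a.coeff n = 0

/-- The projection `P₋` onto the pole part (the terms `aₙ λⁿ` with `n < 0`). -/
def Pminus : Laurent →ₗ[ℂ] Laurent where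
  toFun a := (HahnSeries.truncLT (0 : ℤ) a : LaurentSeries ℂ)
  map_add' a b := (HahnSeries.truncLTLinearMap ℂ (0 : ℤ)).map_add a b
  map_smul' c a := (HahnSeries.truncLTLinearMap ℂ (0 : ℤ)).map_smul c a

theorem coeff_Pminus (a : Laurent) (n : ℤ) :
    (Pminus a).coeff n = if n < 0 then a.coeff n else 0 := by
  split_ifs with h
  · exact HahnSeries.coeff_truncLT_of_lt h a
  · exact HahnSeries.coeff_truncLT_of_le (not_lt.1 h) a

/-- The projection `P₊` onto the holomorphic part. -/
def Pplus : Laurent →ₗ[ℂ] Laurent := LinearMap.id - Pminus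

/-- The power series `e^{cλ}`, as a Laurent series. -/
def expLam (c : ℂ) : Laurent :=
  (HahnSeries.ofPowerSeries ℤ ℂ (PowerSeries.rescale c (PowerSeries.exp ℂ)) : LaurentSeries ℂ)

theorem expLam_zero : expLam 0 = 1 := by
  simp only [expLam, PowerSeries.rescale_zero, RingHom.comp_apply, PowerSeries.constantCoeff_exp,
    map_one]
  rfl

theorem expLam_add (c d : ℂ) : expLam (c + d) = expLam c * expLam d := by
  rw [expLam, ← PowerSeries.exp_mul_exp_eq_exp_add, map_mul]
  rfl

/-! ### Characters -/

/-- The group `G_𝒜` of characters of `H` with values in Laurent series; the product is the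
convolution product, the unit is the counit. -/
abbrev Chr (H : Type*) [CommRing H] [HopfAlgebra ℂ H] := WithConv (H →ₐ[ℂ] Laurent)

section Basic

variable {H : Type*} [CommRing H] [HopfAlgebra ℂ H]

/-- The convolution inverse `φ⁻¹ = φ ∘ S`. -/
instance : Inv (Chr H) where
  inv φ := toConv (φ.ofConv.comp (HopfAlgebra.antipodeAlgHom ℂ H))

/-- A character as an element of the convolution algebra of linear maps `H → 𝒜`. -/
def Chr.lin (φ : Chr H) : WithConv (H →ₗ[ℂ] Laurent) := toConv φ.ofConv.toLinearMap

theorem Chr.lin_injective : Function.Injective (Chr.lin (H := H)) := fun _ _ h =>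
  ofConv_injective (AlgHom.toLinearMap_injective (congrArg WithConv.ofConv h))

theorem Chr.lin_mul (φ ψ : Chr H) : (φ * ψ).lin = φ.lin * ψ.lin := rfl

theorem Chr.lin_one : (1 : Chr H).lin = 1 := rfl

instance : Group (Chr H) where
  inv_mul_cancel φ := by
    apply Chr.lin_injective
    rw [Chr.lin_mul, Chr.lin_one]
    refine WithConv.ext (LinearMap.ext fun x => ?_)
    rw [(ℛ ℂ x).convMul_apply]
    have h := congrArg φ.ofConv (HopfAlgebra.sum_antipode_mul_eq_algebraMap_counit (ℛ ℂ x))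
    rw [map_sum, AlgHom.commutes] at h
    rw [LinearMap.convOne_apply, ← h]
    refine Finset.sum_congr rfl fun i _ => ?_
    exact (map_mul φ.ofConv (HopfAlgebraStruct.antipode ℂ ((ℛ ℂ x).left i))
      ((ℛ ℂ x).right i)).symm

/-! ### Infinitesimal characters -/

/-- If two linear maps on `H` expand as sums of products on products `x y`, so does their
convolution. -/
theorem conv_mul_expand {B : Type*} [CommRing B] [Algebra ℂ B] {ι κ : Type*}
    (s : Finset ι) (u : Finset κ)
    (p q : WithConv (H →ₗ[ℂ] B)) (a b : ι → WithConv (H →ₗ[ℂ] B))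
    (c d : κ → WithConv (H →ₗ[ℂ] B))
    (hp : ∀ x y, p (x * y) = ∑ i ∈ s, a i x * b i y)
    (hq : ∀ x y, q (x * y) = ∑ j ∈ u, c j x * d j y) (x y : H) :
    (p * q) (x * y) = ∑ i ∈ s, ∑ j ∈ u, (a i * c j) x * (b i * d j) y := by
  have e : (p * q) (x * y) = ∑ k ∈ (ℛ ℂ x).index, ∑ l ∈ (ℛ ℂ y).index,
      p ((ℛ ℂ x).left k * (ℛ ℂ y).left l) * q ((ℛ ℂ x).right k * (ℛ ℂ y).right l) := by
    rw [LinearMap.convMul_apply, Bialgebra.comul_mul, ← (ℛ ℂ x).eq, ← (ℛ ℂ y).eq,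
      Finset.sum_mul_sum]
    simp
  rw [e]
  simp only [hp, hq, (ℛ ℂ x).convMul_apply, (ℛ ℂ y).convMul_apply, Finset.sum_mul_sum]
  have r : ∀ k l, (∑ i ∈ s, ∑ j ∈ u,
      a i ((ℛ ℂ x).left k) * b i ((ℛ ℂ y).left l) *
        (c j ((ℛ ℂ x).right k) * d j ((ℛ ℂ y).right l))) =
      ∑ i ∈ s, ∑ j ∈ u, a i ((ℛ ℂ x).left k) * c j ((ℛ ℂ x).right k) *
        (b i ((ℛ ℂ y).left l) * d j ((ℛ ℂ y).right l)) := fun k l =>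
    Finset.sum_congr rfl fun i _ => Finset.sum_congr rfl fun j _ => by ring
  simp only [r]
  calc _ = ∑ k ∈ (ℛ ℂ x).index, ∑ i ∈ s, ∑ l ∈ (ℛ ℂ y).index, ∑ j ∈ u,
        a i ((ℛ ℂ x).left k) * c j ((ℛ ℂ x).right k) *
        (b i ((ℛ ℂ y).left l) * d j ((ℛ ℂ y).right l)) :=
        Finset.sum_congr rfl fun k _ => Finset.sum_comm
    _ = ∑ i ∈ s, ∑ k ∈ (ℛ ℂ x).index, ∑ l ∈ (ℛ ℂ y).index, ∑ j ∈ u,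
        a i ((ℛ ℂ x).left k) * c j ((ℛ ℂ x).right k) *
        (b i ((ℛ ℂ y).left l) * d j ((ℛ ℂ y).right l)) := Finset.sum_comm
    _ = ∑ i ∈ s, ∑ k ∈ (ℛ ℂ x).index, ∑ j ∈ u, ∑ l ∈ (ℛ ℂ y).index,
        a i ((ℛ ℂ x).left k) * c j ((ℛ ℂ x).right k) *
        (b i ((ℛ ℂ y).left l) * d j ((ℛ ℂ y).right l)) :=
        Finset.sum_congr rfl fun i _ => Finset.sum_congr rfl fun k _ => Finset.sum_comm
    _ = _ := Finset.sum_congr rfl fun i _ => Finset.sum_comm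

/-- `D` is tangent at `g`: `D(xy) = D(x) g(y) + g(x) D(y)`. -/
def IsTangent {B : Type*} [CommRing B] [Algebra ℂ B] (g D : WithConv (H →ₗ[ℂ] B)) : Prop :=
  ∀ x y, D (x * y) = D x * g y + g x * D y

/-- `g` is multiplicative. -/
def IsMult {B : Type*} [CommRing B] [Algebra ℂ B] (g : WithConv (H →ₗ[ℂ] B)) : Prop :=
  ∀ x y, g (x * y) = g x * g y

theorem Chr.isMult (φ : Chr H) : IsMult φ.lin := fun x y => map_mul φ.ofConv x y

theorem IsTangent.mul_right {B : Type*} [CommRing B] [Algebra ℂ B]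
    {g D k : WithConv (H →ₗ[ℂ] B)} (hD : IsTangent g D) (hk : IsMult k) :
    IsTangent (g * k) (D * k) := fun x y => by
  have := conv_mul_expand (Finset.univ : Finset (Fin 2)) (Finset.univ : Finset (Fin 1)) D k
    ![D, g] ![g, D] ![k] ![k] (fun x y => by simpa using hD x y)
    (fun x y => by simpa using hk x y) x y
  simpa using this

theorem IsTangent.mul_left {B : Type*} [CommRing B] [Algebra ℂ B]
    {g D k : WithConv (H →ₗ[ℂ] B)} (hD : IsTangent g D) (hk : IsMult k) :
    IsTangent (k * g) (k * D) := fun x y => by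
  have := conv_mul_expand (Finset.univ : Finset (Fin 1)) (Finset.univ : Finset (Fin 2)) k D
    ![k] ![k] ![D, g] ![g, D] (fun x y => by simpa using hk x y)
    (fun x y => by simpa using hD x y) x y
  simpa using this

instance {B : Type*} [CommRing B] [Algebra ℂ B] : LieRing (WithConv (H →ₗ[ℂ] B)) :=
  LieRing.ofAssociativeRing

instance {B : Type*} [CommRing B] [Algebra ℂ B] : LieAlgebra ℂ (WithConv (H →ₗ[ℂ] B)) :=
  LieAlgebra.ofAssociativeAlgebra

/-- The Lie algebra `𝔤_B` of `B`-valued infinitesimal characters: linear maps `Z : H → B` with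
`Z(xy) = Z(x) ε(y) + ε(x) Z(y)`, with bracket `[Z, Z'] = Z ⋆ Z' - Z' ⋆ Z`. -/
def InfChar (H : Type*) [CommRing H] [HopfAlgebra ℂ H] (B : Type*) [CommRing B] [Algebra ℂ B] :
    LieSubalgebra ℂ (WithConv (H →ₗ[ℂ] B)) where
  carrier := {Z | ∀ x y, Z (x * y) = Z x * algebraMap ℂ B (counit (R := ℂ) y) +
    algebraMap ℂ B (counit (R := ℂ) x) * Z y}
  add_mem' {Z W} hZ hW x y := by
    have h1 := hZ x y
    have h2 := hW x y
    simp only [ofConv_add, LinearMap.add_apply, h1, h2]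
    ring
  zero_mem' x y := by simp
  smul_mem' c Z hZ x y := by
    have h1 := hZ x y
    change c • Z (x * y) = c • Z x * algebraMap ℂ B (counit (R := ℂ) y) +
      algebraMap ℂ B (counit (R := ℂ) x) * c • Z y
    rw [h1, smul_add, smul_mul_assoc, mul_smul_comm]
  lie_mem' {Z W} hZ hW := fun x y => by
    have key : ∀ Z W : WithConv (H →ₗ[ℂ] B), IsTangent 1 Z → IsTangent 1 W →
        (Z * W) (x * y) = (Z * W) x * (1 : WithConv (H →ₗ[ℂ] B)) y + Z x * W y + W x * Z y +
          (1 : WithConv (H →ₗ[ℂ] B)) x * (Z * W) y := fun Z W hZ hW => by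
      have := conv_mul_expand (Finset.univ : Finset (Fin 2)) (Finset.univ : Finset (Fin 2)) Z W
        ![Z, 1] ![1, Z] ![W, 1] ![1, W] (fun x y => by simpa using hZ x y)
        (fun x y => by simpa using hW x y) x y
      simp only [Fin.sum_univ_two, Matrix.cons_val_zero, Matrix.cons_val_one, mul_one,
        one_mul] at this
      rw [this]
      ring
    rw [Ring.lie_def]
    have e1 := key Z W hZ hW
    have e2 := key W Z hW hZ
    simp only [ofConv_sub, LinearMap.sub_apply, e1, e2]
    simp only [LinearMap.convOne_apply]
    ring

theorem mem_infChar {B : Type*} [CommRing B] [Algebra ℂ B] {Z : WithConv (H →ₗ[ℂ] B)} :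
    Z ∈ InfChar H B ↔ IsTangent 1 Z := Iff.rfl

/-- Postcomposition `T ∘ Z` of an infinitesimal character with a `ℂ`-linear map of the values. -/
def InfChar.map {B B' : Type*} [CommRing B] [Algebra ℂ B] [CommRing B'] [Algebra ℂ B']
    (T : B →ₗ[ℂ] B') (Z : InfChar H B) : InfChar H B' :=
  ⟨toConv (T ∘ₗ Z.1.ofConv), fun x y => by
    have h := Z.2 x y
    simp only [LinearMap.comp_apply, h, map_add]
    rw [mul_comm (Z.1 x), mul_comm (T (Z.1 x)), ← Algebra.smul_def, ← Algebra.smul_def,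
      ← Algebra.smul_def, ← Algebra.smul_def, map_smul, map_smul]⟩

/-- Scalar-valued infinitesimal characters, seen as (constant) `𝒜`-valued ones: `𝔤_ℂ ⊆ 𝔤_𝒜`. -/
def InfChar.const (b : InfChar H ℂ) : InfChar H Laurent :=
  InfChar.map (Algebra.linearMap ℂ Laurent) b

/-- The value at `λ = 0`, i.e. the constant coefficient (used for holomorphic `Z`). -/
def InfChar.evalZero (Z : InfChar H Laurent) : InfChar H ℂ := InfChar.map (coeffL 0) Z

/-- The adjoint action `Ad(g) Z = g ⋆ Z ⋆ g⁻¹` of `G_𝒜` on `𝔤_𝒜`. -/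
def Ad (g : Chr H) (Z : InfChar H Laurent) : InfChar H Laurent :=
  ⟨g.lin * Z.1 * g⁻¹.lin, by
    have h := (IsTangent.mul_left (mem_infChar.1 Z.2) g.isMult).mul_right (g⁻¹).isMult
    rw [mul_one, ← Chr.lin_mul, mul_inv_cancel] at h
    exact h⟩

/-- `Ad`-covariant maps `f : 𝔤_𝒜 → 𝔤_𝒜`. -/
def AdCovariant (f : InfChar H Laurent → InfChar H Laurent) : Prop :=
  ∀ g Z, Ad g (f Z) = f (Ad g Z)

/-! ### Exponential and Birkhoff decomposition -/

/-- `g = exp(Z) = ∑ₖ Z^{⋆k} / k!`; evaluated at any `x`, the series is a finite sum. -/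
def IsExp (Z : InfChar H Laurent) (g : Chr H) : Prop :=
  ∀ x, ∀ᶠ N : ℕ in Filter.atTop,
    g x = ∑ k ∈ Finset.range N, ((k.factorial : ℂ)⁻¹) • (Z.1 ^ k) x

/-- `g = g₋⁻¹ ⋆ g₊` is the Birkhoff decomposition of `g`: `g₊` is holomorphic in `λ`, and
`g₋` maps the augmentation ideal `ker ε` to polynomials in `λ⁻¹` without constant term. -/
structure IsBirkhoff (g gm gp : Chr H) : Prop where
  eq : g = gm⁻¹ * gp
  polar : ∀ x, counit (R := ℂ) x = 0 → IsPolar (gm x)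
  holo : ∀ x, IsHolo (gp x)

open Classical in
/-- The negative part `g₋` of the Birkhoff decomposition (which exists and is unique when `H` is
connected graded). -/
def negPart (g : Chr H) : Chr H :=
  if h : ∃ p : Chr H × Chr H, IsBirkhoff g p.1 p.2 then h.choose.1 else 1

theorem negPart_polar (g : Chr H) (x : H) (hx : counit (R := ℂ) x = 0) :
    IsPolar (negPart g x) := by
  unfold negPart
  split_ifs with h
  · exact h.choose_spec.polar x hx
  · intro n _
    simp [hx]

end Basic

section Graded

variable {H : Type*} [CommRing H] [HopfAlgebra ℂ H] (𝓗 : ℕ → Submodule ℂ H) [GradedAlgebra 𝓗]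

theorem degOp_of_mem {n : ℕ} {x : H} (hx : x ∈ 𝓗 n) : degOp 𝓗 x = (n : ℂ) • x := by
  lift x to 𝓗 n using hx
  simp only [degOp, LinearMap.comp_apply, LinearEquiv.coe_coe,
    DirectSum.decomposeLinearEquiv_apply, DirectSum.decompose_coe]
  rw [← DirectSum.lof_eq_of ℂ, DirectSum.toModule_lof]
  simp

theorem degOp_mul (x y : H) : degOp 𝓗 (x * y) = degOp 𝓗 x * y + x * degOp 𝓗 y := by
  induction x using DirectSum.Decomposition.inductionOn 𝓗 with
  | zero => simp
  | add a b ha hb => simp only [add_mul, map_add, ha, hb]; ring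
  | @homogeneous m a =>
    induction y using DirectSum.Decomposition.inductionOn 𝓗 with
    | zero => simp
    | add c d hc hd => simp only [mul_add, map_add, hc, hd]; ring
    | @homogeneous n c =>
      rw [degOp_of_mem 𝓗 (SetLike.mul_mem_graded a.2 c.2), degOp_of_mem 𝓗 a.2,
        degOp_of_mem 𝓗 c.2, smul_mul_assoc, mul_smul_comm, ← add_smul]
      push_cast
      rfl

theorem counit_degOp [IsConnectedGraded 𝓗] (x : H) : counit (R := ℂ) (degOp 𝓗 x) = 0 := by
  induction x using DirectSum.Decomposition.inductionOn 𝓗 with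
  | zero => simp
  | add a b ha hb => simp only [map_add, ha, hb, add_zero]
  | @homogeneous m a =>
    rw [degOp_of_mem 𝓗 a.2]
    rcases Nat.eq_zero_or_pos m with rfl | hm
    · simp
    · rw [map_smul, IsConnectedGraded.counit_eq_zero (𝓗 := 𝓗) m hm _ a.2, smul_zero]

theorem isTangent_comp_degOp (φ : Chr H) :
    IsTangent φ.lin (toConv (φ.ofConv.toLinearMap ∘ₗ degOp 𝓗)) := fun x y => by
  change φ.ofConv (degOp 𝓗 (x * y)) =
    φ.ofConv (degOp 𝓗 x) * φ.ofConv y + φ.ofConv x * φ.ofConv (degOp 𝓗 y)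
  rw [degOp_mul, map_add, map_mul, map_mul]

/-- `φᵗ`, with `φᵗ(x)(λ) = e^{tλ|x|} φ(x)(λ)` on homogeneous elements `x`. -/
def twist (φ : Chr H) (t : ℂ) : Chr H :=
  toConv ((DirectSum.toAlgebra ℂ (fun n => 𝓗 n)
    (fun n => LinearMap.mulLeft ℂ (expLam (t * n)) ∘ₗ φ.ofConv.toLinearMap ∘ₗ (𝓗 n).subtype)
    (by
      change expLam (t * ((0 : ℕ) : ℂ)) * φ.ofConv (1 : H) = 1
      rw [Nat.cast_zero, mul_zero, expLam_zero, map_one, one_mul])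
    (fun {i j} a b => by
      change expLam (t * ((i + j : ℕ) : ℂ)) * φ.ofConv ((a : H) * (b : H)) =
        expLam (t * i) * φ.ofConv (a : H) * (expLam (t * j) * φ.ofConv (b : H))
      rw [Nat.cast_add, mul_add, expLam_add, map_mul]
      ring)).comp (DirectSum.decomposeAlgEquiv 𝓗).toAlgHom)

/-- Sanity check for `twist`. -/
theorem twist_of_mem (φ : Chr H) (t : ℂ) {n : ℕ} {x : H} (hx : x ∈ 𝓗 n) :
    twist 𝓗 φ t x = expLam (t * n) * φ x := by
  lift x to 𝓗 n using hx
  change DirectSum.toModule ℂ ℕ Laurent _ (DirectSum.decompose 𝓗 (x : H)) = _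
  rw [DirectSum.decompose_coe, ← DirectSum.lof_eq_of ℂ, DirectSum.toModule_lof]
  rfl

/-- `φ` is local (`φ ∈ G^Φ_𝒜`): the negative part of the Birkhoff decomposition of `φᵗ` does not
depend on `t`. -/
def IsLocal (φ : Chr H) : Prop := ∀ s t : ℂ, negPart (twist 𝓗 φ s) = negPart (twist 𝓗 φ t)

/-- `R̃(φ) = φ⁻¹ ⋆ (φ ∘ Y)`. -/
def Rtilde (φ : Chr H) : InfChar H Laurent :=
  ⟨φ⁻¹.lin * toConv (φ.ofConv.toLinearMap ∘ₗ degOp 𝓗), by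
    have h := (isTangent_comp_degOp 𝓗 φ).mul_left (φ⁻¹).isMult
    rw [← Chr.lin_mul, inv_mul_cancel] at h
    exact h⟩

/-- `λ R̃(φ)`. -/
def lamRtilde (φ : Chr H) : InfChar H Laurent :=
  InfChar.map (LinearMap.mulLeft ℂ lam) (Rtilde 𝓗 φ)

theorem residue_mul_of_polar {a b : Laurent} (ha : IsPolar a) (hb : IsPolar b) :
    (a * b).coeff (-1) = 0 := by
  refine (HahnSeries.coeff_mul (R := ℂ) (Γ := ℤ)).trans (Finset.sum_eq_zero fun p hp => ?_)
  have hp' : p.1 + p.2 = -1 := (Finset.mem_antidiagonal.1 hp).2.2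
  change a.coeff p.1 * b.coeff p.2 = (0 : ℂ)
  rcases le_or_gt 0 p.1 with h | h
  · rw [ha p.1 h, zero_mul]
  · rw [hb p.2 (by omega), mul_zero]

/-- The `β`-function `β_φ = -Res(φ₋) ∘ Y` of a character, an element of `𝔤_ℂ`; here `Res` is the
coefficient of `λ⁻¹`. -/
def betaFun [IsConnectedGraded 𝓗] (φ : Chr H) : InfChar H ℂ :=
  ⟨toConv (-(coeffL (-1) ∘ₗ (negPart φ).ofConv.toLinearMap ∘ₗ degOp 𝓗)), fun x y => by
    have key : ∀ u v : H, counit (R := ℂ) u = 0 →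
        (negPart φ (u * v)).coeff (-1) = counit (R := ℂ) v * (negPart φ u).coeff (-1) := by
      intro u v hu
      have h1 : u * v = u * (v - algebraMap ℂ H (counit (R := ℂ) v)) +
          counit (R := ℂ) v • u := by
        rw [Algebra.smul_def]; ring
      rw [h1, map_add, map_mul, map_smul, Laurent.coeff_add, Laurent.coeff_smul,
        residue_mul_of_polar (negPart_polar φ u hu) (negPart_polar φ _ (by simp)), zero_add]
    change -((negPart φ (degOp 𝓗 (x * y))).coeff (-1)) =
      -((negPart φ (degOp 𝓗 x)).coeff (-1)) * counit (R := ℂ) y +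
        counit (R := ℂ) x * -((negPart φ (degOp 𝓗 y)).coeff (-1))
    rw [degOp_mul, map_add, Laurent.coeff_add, mul_comm x, key _ _ (counit_degOp 𝓗 x),
      key _ _ (counit_degOp 𝓗 y)]
    ring⟩

end Graded

/-! ### The Lax pair flow -/

section Lax

variable {H : Type*} [CommRing H] [HopfAlgebra ℂ H]

/-- `M = ½ R(f(L))` with `R = P₊ - P₋` acting on values. -/
def laxM (f : InfChar H Laurent → InfChar H Laurent) (L : InfChar H Laurent) :
    InfChar H Laurent :=
  (1 / 2 : ℂ) • InfChar.map (Pplus - Pminus) (f L)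

/-- `L(t)`, `t ∈ ℝ`, solves the Lax pair equation `dL/dt = [L, M]`, `M = ½ R(f(L))`, with
`L(0) = L₀`.  Derivatives in `t` are taken for each coefficient of each `L(t)(x)`. -/
structure IsLaxSolution (f : InfChar H Laurent → InfChar H Laurent) (L₀ : InfChar H Laurent)
    (L : ℝ → InfChar H Laurent) : Prop where
  init : L 0 = L₀
  lax : ∀ (t : ℝ) (x : H) (n : ℤ),
    HasDerivAt (fun s : ℝ => ((L s).1 x).coeff n) ((⁅L t, laxM f (L t)⁆.1 x).coeff n) t

/-- `L(t) = Ad(g₊(t)) L₀ = Ad(g₋(t)) L₀`, where `exp(-t f(L₀)) = g₋(t)⁻¹ ⋆ g₊(t)` is the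
Birkhoff decomposition. -/
def IsFactorizationFlow (f : InfChar H Laurent → InfChar H Laurent) (L₀ : InfChar H Laurent)
    (L : ℝ → InfChar H Laurent) : Prop :=
  ∀ t : ℝ, ∃ e gm gp : Chr H, IsExp ((-(t : ℂ)) • f L₀) e ∧ IsBirkhoff e gm gp ∧
    L t = Ad gp L₀ ∧ L t = Ad gm L₀

end Lax

end LaxBeta

end

noncomputable section

namespace LaxBeta

/-! ### Graded linear maps and the convolution product -/

section GradedMaps

variable {H : Type*} [CommRing H] [HopfAlgebra ℂ H] (𝓗 : ℕ → Submodule ℂ H) [GradedAlgebra 𝓗]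
  {B : Type*} [CommRing B] [Algebra ℂ B]

/-! The flow matters only through the holomorphy of `L(t)`; the rest is a correspondence between
scalar infinitesimal characters and polar local characters. Write `b` for a scalar infinitesimal
character and `ζ` for the character with `λR̃(ζ) = b`, that is, `λ (ζ ∘ Y) = ζ ⋆ b`. Solving this
equation degree by degree shows that `ζ` is polar. Hence `ζ₋ = ζ⁻¹`, and comparing constant
coefficients gives `β_ζ = b` (`betaFun_eq_of_lamRtilde_eq_const`). Moreover `ζ⁻¹ ⋆ ζˢ` is
holomorphic for every `s`, so `(ζˢ)₋ = ζ⁻¹` does not depend on `s`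
(`isLocal_of_lamRtilde_eq_const`). Conversely, for a local `φ`, `λR̃((φ₋)⁻¹) = β_φ`
(`IsLocal.lamRtilde_inv_negPart`), which identifies `ξ₀`.

Covariance forces `f(L)` to commute with `L`: `exp(cL)` fixes `L` under `Ad`, hence fixes `f(L)`,
and one differentiates at `c = 0` (`AdCovariant.commute`). As `½R = P₊ - ½`, the Lax equation
becomes `dL/dt = [L, P₊ f(L)]`. Infinitesimal characters vanish in degree zero, so in degree `n` the
right side involves only lower degrees of `L`; by induction the negative coefficients are constant
in `t`, hence zero (`IsLaxSolution.isHolo`). This covers every solution, with no uniqueness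
statement.

For existence, `exp(-t f(L₀))` is polynomial in `t` on each element of `H`. The Birkhoff recursion
runs over `𝒜[t]` as well as over `𝒜`, so the factors are polynomial in `t` too and can be
differentiated formally (`AdCovariant.exists_laxSolution`). -/

/-- The linear map which agrees with `T n` on the elements of degree `n`. -/
def degreewise {V : Type*} [AddCommGroup V] [Module ℂ V] (T : ℕ → H →ₗ[ℂ] V) : H →ₗ[ℂ] V :=
  DirectSum.toModule ℂ ℕ V (fun n => T n ∘ₗ (𝓗 n).subtype) ∘ₗ
    (DirectSum.decomposeLinearEquiv 𝓗).toLinearMap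

theorem degreewise_of_mem {V : Type*} [AddCommGroup V] [Module ℂ V] (T : ℕ → H →ₗ[ℂ] V) {n : ℕ}
    {x : H} (hx : x ∈ 𝓗 n) : degreewise 𝓗 T x = T n x := by
  lift x to 𝓗 n using hx
  simp only [degreewise, LinearMap.comp_apply, LinearEquiv.coe_coe,
    DirectSum.decomposeLinearEquiv_apply, DirectSum.decompose_coe]
  rw [← DirectSum.lof_eq_of ℂ, DirectSum.toModule_lof]
  simp

theorem linearMap_ext_of_homogeneous {V : Type*} [AddCommGroup V] [Module ℂ V] {p q : H →ₗ[ℂ] V}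
    (h : ∀ n, ∀ x ∈ 𝓗 n, p x = q x) : p = q := by
  ext x
  induction x using DirectSum.Decomposition.inductionOn 𝓗 with
  | zero => simp
  | add a b ha hb => simp only [map_add, ha, hb]
  | @homogeneous m a => exact h m a a.2

/-- `p` vanishes in all degrees `< n`. -/
def VanishesBelow (n : ℕ) (p : WithConv (H →ₗ[ℂ] B)) : Prop :=
  ∀ i < n, ∀ x ∈ 𝓗 i, p x = 0

variable {𝓗}

theorem eq_of_vanishesBelow_sub {p q : WithConv (H →ₗ[ℂ] B)}
    (h : ∀ n, VanishesBelow 𝓗 n (p - q)) : p = q := by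
  refine WithConv.ext (linearMap_ext_of_homogeneous 𝓗 fun n x hx => ?_)
  exact sub_eq_zero.1 (h (n + 1) n n.lt_succ_self x hx)

omit [GradedAlgebra 𝓗] in
theorem VanishesBelow.sub {n : ℕ} {p q : WithConv (H →ₗ[ℂ] B)} (hp : VanishesBelow 𝓗 n p)
    (hq : VanishesBelow 𝓗 n q) : VanishesBelow 𝓗 n (p - q) := fun i hi x hx => by
  change p x - q x = 0
  rw [hp i hi x hx, hq i hi x hx, sub_zero]

omit [GradedAlgebra 𝓗] in
theorem VanishesBelow.mono {m n : ℕ} (hmn : m ≤ n) {p : WithConv (H →ₗ[ℂ] B)}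
    (hp : VanishesBelow 𝓗 n p) : VanishesBelow 𝓗 m p :=
  fun i hi x hx => hp i (hi.trans_le hmn) x hx

omit [GradedAlgebra 𝓗] in
theorem vanishesBelow_zero (p : WithConv (H →ₗ[ℂ] B)) : VanishesBelow 𝓗 0 p :=
  fun _ hi => absurd hi (Nat.not_lt_zero _)

variable (𝓗) in
/-- A locally finite sum of linear maps. -/
theorem exists_locally_finite_sum (u : ℕ → WithConv (H →ₗ[ℂ] B))
    (hu : ∀ k, VanishesBelow 𝓗 k (u k)) :
    ∃ g : WithConv (H →ₗ[ℂ] B), ∀ N, VanishesBelow 𝓗 N (g - ∑ k ∈ Finset.range N, u k) := by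
  -- In degree `n` only the terms with `k ≤ n` can be nonzero.
  refine ⟨toConv (degreewise 𝓗 fun n => (∑ k ∈ Finset.range (n + 1), u k).ofConv),
    fun N i hi x hx => ?_⟩
  change degreewise 𝓗 _ x - (∑ k ∈ Finset.range N, u k).ofConv x = 0
  rw [degreewise_of_mem 𝓗 _ hx, sub_eq_zero, ofConv_sum, ofConv_sum, LinearMap.sum_apply,
    LinearMap.sum_apply]
  refine Finset.sum_subset (Finset.range_subset_range.2 hi) fun k _ hk => ?_
  exact hu k i (by simpa using hk) x hx

variable [IsConnectedGraded 𝓗]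

theorem exists_eq_algebraMap_of_mem_zero {x : H} (hx : x ∈ 𝓗 0) :
    x = algebraMap ℂ H (counit (R := ℂ) x) := by
  rw [IsConnectedGraded.zero_eq (𝓗 := 𝓗)] at hx
  obtain ⟨c, rfl⟩ := Submodule.mem_span_singleton.1 hx
  simp [Algebra.algebraMap_eq_smul_one]

/-- The coproduct of a homogeneous element as a sum of tensors of homogeneous elements. -/
theorem exists_homogeneous_repr {n : ℕ} {x : H} (hx : x ∈ 𝓗 n) :
    ∃ (k : ℕ) (r : Coalgebra.Repr ℂ x (Fin k)), ∀ i, ∃ a b, a + b = n ∧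
      r.left i ∈ 𝓗 a ∧ r.right i ∈ 𝓗 b := by
  have h := IsConnectedGraded.comul_mem (𝓗 := 𝓗) n x hx
  have hle : (⨆ p ∈ Finset.HasAntidiagonal.antidiagonal n,
      LinearMap.range (TensorProduct.map (𝓗 p.1).subtype (𝓗 p.2).subtype)) ≤
      Submodule.span ℂ {t : H ⊗[ℂ] H | ∃ l r : H, l ⊗ₜ[ℂ] r = t ∧
        ∃ a b, a + b = n ∧ l ∈ 𝓗 a ∧ r ∈ 𝓗 b} := by
    refine iSup₂_le fun p hp => ?_
    rintro _ ⟨t, rfl⟩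
    induction t using TensorProduct.induction_on with
    | zero => simp
    | add s t hs ht => rw [map_add]; exact add_mem hs ht
    | tmul l r =>
      exact Submodule.subset_span ⟨l, r, rfl, p.1, p.2, Finset.HasAntidiagonal.mem_antidiagonal.1 hp, l.2, r.2⟩
  obtain ⟨k, c, g, hg⟩ := Submodule.mem_span_set'.1 (hle h)
  choose l r hlr a b hab hl hr using fun i => (g i).2
  refine ⟨k, ⟨Finset.univ, fun i => c i • l i, r, ?_⟩, fun i =>
    ⟨a i, b i, hab i, (𝓗 (a i)).smul_mem _ (hl i), hr i⟩⟩
  rw [← hg]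
  refine Finset.sum_congr rfl fun i _ => ?_
  rw [← hlr i, TensorProduct.smul_tmul']

/-- A convolution product evaluated at a homogeneous element lies in a submodule which contains
the products of the values at homogeneous elements of complementary degrees. -/
theorem convMul_mem (S : Submodule ℂ B) {p q : WithConv (H →ₗ[ℂ] B)} {n : ℕ} {x : H}
    (hx : x ∈ 𝓗 n)
    (h : ∀ i j, i + j = n → ∀ a ∈ 𝓗 i, ∀ b ∈ 𝓗 j, p a * q b ∈ S) : (p * q) x ∈ S := by
  obtain ⟨k, r, hr⟩ := exists_homogeneous_repr hx
  rw [r.convMul_apply]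
  refine sum_mem fun i _ => ?_
  obtain ⟨a, b, hab, hl, hr⟩ := hr i
  exact h a b hab _ hl _ hr

/-- `p` is zero on `1`, hence in degree zero. -/
theorem apply_eq_zero_of_mem_zero {p : WithConv (H →ₗ[ℂ] B)} (hp : p 1 = 0) {x : H}
    (hx : x ∈ 𝓗 0) : p x = 0 := by
  rw [exists_eq_algebraMap_of_mem_zero hx, Algebra.algebraMap_eq_smul_one, map_smul, hp, smul_zero]

theorem VanishesBelow.mul_right {n : ℕ} {p : WithConv (H →ₗ[ℂ] B)} (hp : VanishesBelow 𝓗 n p)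
    (q : WithConv (H →ₗ[ℂ] B)) : VanishesBelow 𝓗 n (p * q) := fun m hm x hx => by
  refine (Submodule.mem_bot ℂ).1 (convMul_mem ⊥ hx fun i j hij a ha b _ => ?_)
  rw [Submodule.mem_bot, hp i (by omega) a ha, zero_mul]

theorem VanishesBelow.mul_left {n : ℕ} {p : WithConv (H →ₗ[ℂ] B)} (hp : VanishesBelow 𝓗 n p)
    (q : WithConv (H →ₗ[ℂ] B)) : VanishesBelow 𝓗 n (q * p) := fun m hm x hx => by
  refine (Submodule.mem_bot ℂ).1 (convMul_mem ⊥ hx fun i j hij a _ b hb => ?_)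
  rw [Submodule.mem_bot, hp j (by omega) b hb, mul_zero]

/-- In each surviving term `q` takes an argument of positive degree, which leaves one degree less
for `p`. Every degree recursion below rests on this gain. -/
theorem VanishesBelow.mul_succ {n : ℕ} {p : WithConv (H →ₗ[ℂ] B)} (hp : VanishesBelow 𝓗 n p)
    {q : WithConv (H →ₗ[ℂ] B)} (hq : q 1 = 0) : VanishesBelow 𝓗 (n + 1) (p * q) :=
  fun m hm x hx => by
    refine (Submodule.mem_bot ℂ).1 (convMul_mem ⊥ hx fun i j hij a ha b hb => ?_)
    rw [Submodule.mem_bot]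
    rcases Nat.eq_zero_or_pos j with rfl | hj
    · rw [apply_eq_zero_of_mem_zero hq hb, mul_zero]
    · rw [hp i (by omega) a ha, zero_mul]

omit [IsConnectedGraded 𝓗] in
variable (𝓗) in
/-- A fixed point equation whose operator raises the degree has a solution. -/
theorem exists_eq_add_of_raises (K : WithConv (H →ₗ[ℂ] B) →+ WithConv (H →ₗ[ℂ] B))
    (hK : ∀ n g, VanishesBelow 𝓗 n g → VanishesBelow 𝓗 (n + 1) (K g))
    (c : WithConv (H →ₗ[ℂ] B)) : ∃ g, g = c + K g := by
  -- The solution is the Neumann series `∑ K^k c`, which is locally finite.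
  have hu : ∀ k, VanishesBelow 𝓗 k (K^[k] c) := by
    intro k
    induction k with
    | zero => exact vanishesBelow_zero _
    | succ k ih => rw [Function.iterate_succ_apply']; exact hK k _ ih
  obtain ⟨g, hg⟩ := exists_locally_finite_sum 𝓗 _ hu
  refine ⟨g, eq_of_vanishesBelow_sub (𝓗 := 𝓗) fun n => ?_⟩
  have e : g - (c + K g) = (g - ∑ k ∈ Finset.range (n + 1), K^[k] c) -
      K (g - ∑ k ∈ Finset.range n, K^[k] c) := by
    rw [Finset.sum_range_succ', map_sub, map_sum]
    simp only [Function.iterate_succ_apply', Function.iterate_zero_apply]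
    abel
  rw [e]
  exact ((hg (n + 1)).mono n.le_succ).sub ((hK n _ (hg n)).mono n.le_succ)

/-! ### Multiplicativity -/

omit [GradedAlgebra 𝓗] [IsConnectedGraded 𝓗] in
theorem convMul_apply_mul {x y : H} {ι κ : Type*} (r : Coalgebra.Repr ℂ x ι)
    (s : Coalgebra.Repr ℂ y κ) (p q : WithConv (H →ₗ[ℂ] B)) :
    (p * q) (x * y) = ∑ i ∈ r.index, ∑ j ∈ s.index,
      p (r.left i * s.left j) * q (r.right i * s.right j) := by
  rw [LinearMap.convMul_apply, Bialgebra.comul_mul, ← r.eq, ← s.eq, Finset.sum_mul_sum]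
  simp

/-- The failure of `p` to be multiplicative. -/
def multDefect (p : WithConv (H →ₗ[ℂ] B)) (x y : H) : B := p (x * y) - p x * p y

omit [GradedAlgebra 𝓗] [IsConnectedGraded 𝓗] in
-- As `Δ(xy) = Δ(x) Δ(y)`, the defect is transported by convolution over `H ⊗ H` with `q ⊗ q`.
theorem multDefect_convMul {x y : H} {ι κ : Type*} (r : Coalgebra.Repr ℂ x ι)
    (s : Coalgebra.Repr ℂ y κ) (p : WithConv (H →ₗ[ℂ] B)) {q : WithConv (H →ₗ[ℂ] B)}
    (hq : IsMult q) :
    multDefect (p * q) x y = ∑ i ∈ r.index, ∑ j ∈ s.index,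
      multDefect p (r.left i) (s.left j) * (q (r.right i) * q (s.right j)) := by
  rw [multDefect, convMul_apply_mul r s, r.convMul_apply, s.convMul_apply, Finset.sum_mul_sum,
    ← Finset.sum_sub_distrib]
  refine Finset.sum_congr rfl fun i _ => ?_
  rw [← Finset.sum_sub_distrib]
  refine Finset.sum_congr rfl fun j _ => ?_
  rw [hq, multDefect]
  ring

omit [GradedAlgebra 𝓗] [IsConnectedGraded 𝓗] in
theorem isMult_one : IsMult (1 : WithConv (H →ₗ[ℂ] B)) := fun x y => by simp

omit [GradedAlgebra 𝓗] [IsConnectedGraded 𝓗] in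
theorem multDefect_convMul_tangent {x y : H} {ι κ : Type*} (r : Coalgebra.Repr ℂ x ι)
    (s : Coalgebra.Repr ℂ y κ) (p : WithConv (H →ₗ[ℂ] B)) {q : WithConv (H →ₗ[ℂ] B)}
    (hq : IsTangent 1 q) :
    (p * q) (x * y) - (p * q) x * p y - p x * (p * q) y = ∑ i ∈ r.index, ∑ j ∈ s.index,
      multDefect p (r.left i) (s.left j) *
        (q (r.right i) * algebraMap ℂ B (counit (R := ℂ) (s.right j)) +
          algebraMap ℂ B (counit (R := ℂ) (r.right i)) * q (s.right j)) := by
  have e1 : p x = (p * 1) x := by rw [mul_one]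
  have e2 : p y = (p * 1) y := by rw [mul_one]
  rw [e1, e2, convMul_apply_mul r s, r.convMul_apply, s.convMul_apply, r.convMul_apply,
    s.convMul_apply, Finset.sum_mul_sum, Finset.sum_mul_sum,
    ← Finset.sum_sub_distrib, ← Finset.sum_sub_distrib]
  refine Finset.sum_congr rfl fun i _ => ?_
  rw [← Finset.sum_sub_distrib, ← Finset.sum_sub_distrib]
  refine Finset.sum_congr rfl fun j _ => ?_
  rw [hq, multDefect]
  simp only [LinearMap.convOne_apply]
  ring

/-- The defects in lower degree determine the defect of a convolution product. -/
theorem multDefect_convMul_eq {m n : ℕ} {x y : H} (hx : x ∈ 𝓗 m) (hy : y ∈ 𝓗 n)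
    {p q : WithConv (H →ₗ[ℂ] B)} (hq : IsMult q) (hq1 : q 1 = 1)
    (h : ∀ i j, i + j < m + n → ∀ a ∈ 𝓗 i, ∀ b ∈ 𝓗 j, multDefect p a b = 0) :
    multDefect (p * q) x y = multDefect p x y := by
  obtain ⟨k, r, hr⟩ := exists_homogeneous_repr hx
  obtain ⟨l, s, hs⟩ := exists_homogeneous_repr hy
  conv_rhs => rw [← mul_one p]
  rw [multDefect_convMul r s p hq, multDefect_convMul r s p isMult_one]
  refine Finset.sum_congr rfl fun i _ => Finset.sum_congr rfl fun j _ => ?_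
  obtain ⟨a, b, hab, ha, hb⟩ := hr i
  obtain ⟨c, d, hcd, hc, hd⟩ := hs j
  by_cases hlt : a + c < m + n
  · rw [h a c hlt _ ha _ hc, zero_mul, zero_mul]
  -- In the terms of top degree on the left, `q` sees only degree zero, where it agrees with the
  -- unit.
  · obtain rfl : b = 0 := by omega
    obtain rfl : d = 0 := by omega
    have key : ∀ z ∈ 𝓗 0, q z = (1 : WithConv (H →ₗ[ℂ] B)) z := fun z hz => by
      have h1 : (q - 1) 1 = 0 := by
        change q 1 - (1 : WithConv (H →ₗ[ℂ] B)) 1 = 0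
        rw [hq1, LinearMap.convOne_apply, Bialgebra.counit_one, map_one, sub_self]
      exact sub_eq_zero.1 (apply_eq_zero_of_mem_zero h1 hz)
    rw [key _ hb, key _ hd]

omit [GradedAlgebra 𝓗] [IsConnectedGraded 𝓗] in
theorem IsTangent.apply_one {q : WithConv (H →ₗ[ℂ] B)} (hq : IsTangent 1 q) : q 1 = 0 := by
  have h := hq 1 1
  simpa using h

/-- `q` vanishes in degree zero, so only defects of `p` of total degree below `m + n` enter. This is
the induction step proving that solutions of equations `Dp = p ⋆ q`, with `D` a derivation, are
multiplicative. -/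
theorem convMul_tangent_leibniz {m n : ℕ} {x y : H} (hx : x ∈ 𝓗 m) (hy : y ∈ 𝓗 n)
    {p q : WithConv (H →ₗ[ℂ] B)} (hq : IsTangent 1 q)
    (h : ∀ i j, i + j < m + n → ∀ a ∈ 𝓗 i, ∀ b ∈ 𝓗 j, multDefect p a b = 0) :
    (p * q) (x * y) = (p * q) x * p y + p x * (p * q) y := by
  obtain ⟨k, r, hr⟩ := exists_homogeneous_repr hx
  obtain ⟨l, s, hs⟩ := exists_homogeneous_repr hy
  rw [← sub_eq_zero, ← sub_sub, multDefect_convMul_tangent r s p hq]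
  refine Finset.sum_eq_zero fun i _ => Finset.sum_eq_zero fun j _ => ?_
  obtain ⟨a, b, hab, ha, hb⟩ := hr i
  obtain ⟨c, d, hcd, hc, hd⟩ := hs j
  by_cases hlt : a + c < m + n
  · rw [h a c hlt _ ha _ hc, zero_mul]
  · obtain rfl : b = 0 := by omega
    obtain rfl : d = 0 := by omega
    rw [apply_eq_zero_of_mem_zero hq.apply_one hb, apply_eq_zero_of_mem_zero hq.apply_one hd]
    ring

omit [IsConnectedGraded 𝓗] in
/-- Multiplicativity may be checked by induction on the degree. -/
theorem isMult_of_induction {p : WithConv (H →ₗ[ℂ] B)}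
    (h : ∀ m n, (∀ i j, i + j < m + n → ∀ a ∈ 𝓗 i, ∀ b ∈ 𝓗 j, multDefect p a b = 0) →
      ∀ x ∈ 𝓗 m, ∀ y ∈ 𝓗 n, multDefect p x y = 0) : IsMult p := by
  have key : ∀ N m n, m + n = N → ∀ x ∈ 𝓗 m, ∀ y ∈ 𝓗 n, multDefect p x y = 0 := by
    intro N
    induction N using Nat.strong_induction_on with
    | _ N ih =>
      rintro m n rfl
      exact h m n fun i j hij => ih _ hij i j rfl
  intro x y
  induction x using DirectSum.Decomposition.inductionOn 𝓗 with
  | zero => simp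
  | add a b ha hb => simp only [add_mul, map_add, ha, hb]
  | @homogeneous m a =>
    induction y using DirectSum.Decomposition.inductionOn 𝓗 with
    | zero => simp
    | add c d hc hd => simp only [mul_add, map_add, hc, hd]
    | @homogeneous n c => exact sub_eq_zero.1 (key _ m n rfl a a.2 c c.2)

end GradedMaps

/-! ### Existence of the Birkhoff decomposition -/

section Birkhoff

variable {H : Type*} [CommRing H] [HopfAlgebra ℂ H] {𝓗 : ℕ → Submodule ℂ H} [GradedAlgebra 𝓗]
  [IsConnectedGraded 𝓗] {B : Type*} [CommRing B] [Algebra ℂ B]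

omit [GradedAlgebra 𝓗] [IsConnectedGraded 𝓗] in
theorem convMul_apply_one (p q : WithConv (H →ₗ[ℂ] B)) : (p * q) 1 = p 1 * q 1 := by
  rw [LinearMap.convMul_apply, Bialgebra.comul_one, Algebra.TensorProduct.one_def,
    TensorProduct.map_tmul, LinearMap.mul'_apply]

/-- Degree zero consists of scalars, where multiplicativity is linearity together with `p 1 = 1`. -/
theorem isMult_of_pos_degree {p : WithConv (H →ₗ[ℂ] B)} (hp : p 1 = 1)
    (h : ∀ m n, 0 < m → 0 < n →
      (∀ i j, i + j < m + n → ∀ a ∈ 𝓗 i, ∀ b ∈ 𝓗 j, multDefect p a b = 0) →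
      ∀ x ∈ 𝓗 m, ∀ y ∈ 𝓗 n, multDefect p x y = 0) : IsMult p := by
  refine isMult_of_induction (𝓗 := 𝓗) fun m n ih x hx y hy => ?_
  rcases Nat.eq_zero_or_pos m with rfl | hm
  · rw [exists_eq_algebraMap_of_mem_zero hx, multDefect, Algebra.algebraMap_eq_smul_one,
      smul_mul_assoc, one_mul, map_smul, map_smul, hp, smul_mul_assoc, one_mul, sub_self]
  rcases Nat.eq_zero_or_pos n with rfl | hn
  · rw [exists_eq_algebraMap_of_mem_zero hy, multDefect, Algebra.algebraMap_eq_smul_one,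
      mul_smul_comm, mul_one, map_smul, map_smul, hp, mul_smul_comm, mul_one, sub_self]
  exact h m n hm hn ih x hx y hy

/-- `P` is the projection onto the first summand of a decomposition `B = N ⊕ O` into two
multiplicatively closed subspaces, the second one containing `1`. -/
structure IsSplitting (P : B →ₗ[ℂ] B) (N O : Submodule ℂ B) : Prop where
  mem_left : ∀ b, P b ∈ N
  mem_right : ∀ b, b - P b ∈ O
  disjoint : ∀ b ∈ N, b ∈ O → b = 0
  mul_left : ∀ a ∈ N, ∀ b ∈ N, a * b ∈ N
  mul_right : ∀ a ∈ O, ∀ b ∈ O, a * b ∈ O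
  one_mem : 1 ∈ O

omit [GradedAlgebra 𝓗] [IsConnectedGraded 𝓗] in
variable (𝓗) in
-- Bogoliubov's recursion `g = ε - P(g ⋆ (φ - ε))` raises the degree, hence is solvable, and gives
-- `g ⋆ φ = ε + (id - P)(g ⋆ (φ - ε))`. Multiplicativity goes by induction on the degree: the defect
-- of `g` lies in `N`, and it equals the defect of `g ⋆ φ`, which lies in `O`; so it is zero. The
-- abstract splitting serves both `𝒜` and `𝒜[t]`.
theorem exists_birkhoff [GradedAlgebra 𝓗] [IsConnectedGraded 𝓗] {P : B →ₗ[ℂ] B} {N O : Submodule ℂ B} (hP : IsSplitting P N O)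
    (φ : H →ₐ[ℂ] B) :
    ∃ g : H →ₐ[ℂ] B, (∀ x, counit (R := ℂ) x = 0 → g x ∈ N) ∧
      ∀ x, (toConv g.toLinearMap * toConv φ.toLinearMap) x ∈ O := by
  set φl : WithConv (H →ₗ[ℂ] B) := toConv φ.toLinearMap with hφl
  have hφ1 : φl 1 = 1 := map_one φ
  have hφm : IsMult φl := fun x y => map_mul φ x y
  have hφ0 : (φl - 1) 1 = 0 := by
    change φl 1 - (1 : WithConv (H →ₗ[ℂ] B)) 1 = 0
    simp [hφ1]
  let K : WithConv (H →ₗ[ℂ] B) →+ WithConv (H →ₗ[ℂ] B) :=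
    AddMonoidHom.mk' (fun g => toConv (-(P ∘ₗ (g * (φl - 1)).ofConv))) fun g g' => by
      rw [add_mul, ofConv_add, LinearMap.comp_add, neg_add, toConv_add]
  have hK : ∀ g x, K g x = -P ((g * (φl - 1)) x) := fun _ _ => rfl
  obtain ⟨g, hg⟩ := exists_eq_add_of_raises 𝓗 K (fun n g hg i hi x hx => by
    rw [hK, hg.mul_succ hφ0 i hi x hx, map_zero, neg_zero]) 1
  have hgx : ∀ x, g x = algebraMap ℂ B (counit (R := ℂ) x) - P ((g * φl) x - g x) := fun x => by
    conv_lhs => rw [hg]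
    change (1 : WithConv (H →ₗ[ℂ] B)) x + K g x = _
    rw [LinearMap.convOne_apply, hK, mul_sub, mul_one, ofConv_sub, LinearMap.sub_apply]
    exact (sub_eq_add_neg _ _).symm
  have hneg : ∀ x, counit (R := ℂ) x = 0 → g x ∈ N := fun x hx => by
    rw [hgx, hx, map_zero, zero_sub]
    exact N.neg_mem (hP.mem_left _)
  have hpos : ∀ x, (g * φl) x ∈ O := fun x => by
    have e : (g * φl) x = counit (R := ℂ) x • 1 +
        (((g * φl) x - g x) - P ((g * φl) x - g x)) := by
      rw [← Algebra.algebraMap_eq_smul_one]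
      linear_combination hgx x
    rw [e]
    exact add_mem (O.smul_mem _ hP.one_mem) (hP.mem_right _)
  have hg1 : g 1 = 1 := by
    have h1 : (g * φl) 1 = g 1 := by rw [convMul_apply_one, hφ1, mul_one]
    simpa [h1] using hgx 1
  have hgm : IsMult g := isMult_of_pos_degree (𝓗 := 𝓗) hg1 fun m n hm hn ih x hx y hy => by
    have hεx := IsConnectedGraded.counit_eq_zero (𝓗 := 𝓗) m hm x hx
    have hεy := IsConnectedGraded.counit_eq_zero (𝓗 := 𝓗) n hn y hy
    refine hP.disjoint _ (sub_mem (hneg _ ?_) (hP.mul_left _ (hneg x hεx) _ (hneg y hεy))) ?_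
    · rw [Bialgebra.counit_mul, hεx, zero_mul]
    · have e := multDefect_convMul_eq hx hy hφm hφ1 ih
      change multDefect g x y ∈ O
      rw [← e]
      exact sub_mem (hpos _) (hP.mul_right _ (hpos x) _ (hpos y))
  exact ⟨AlgHom.ofLinearMap g.ofConv hg1 hgm, hneg, hpos⟩

end Birkhoff

/-! ### Polar and holomorphic Laurent series -/

/-- Replaces the support-dependent index set of `HahnSeries.coeff_mul` by any finite set that
carries the nonzero terms, so that one set can serve a whole family. -/
theorem Laurent.coeff_mul_eq_sum (a b : Laurent) (n : ℤ) (s : Finset ℤ)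
    (h : ∀ i, i ∉ s → a.coeff i * b.coeff (n - i) = 0) :
    (a * b).coeff n = ∑ i ∈ s, a.coeff i * b.coeff (n - i) := by
  refine (HahnSeries.coeff_mul (R := ℂ) (Γ := ℤ)).trans ?_
  refine Finset.sum_of_injOn Prod.fst (fun p hp q hq hpq => ?_) (fun p hp => ?_) (fun i hi hi' => ?_)
    fun p hp => ?_
  · have h1 := (Finset.mem_antidiagonal.1 hp).2.2
    have h2 := (Finset.mem_antidiagonal.1 hq).2.2
    exact Prod.ext hpq (by change p.1 = q.1 at hpq; omega)
  · have h1 := Finset.mem_antidiagonal.1 hp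
    by_contra hi
    have h2 := h p.1 hi
    rw [show n - p.1 = p.2 by omega] at h2
    exact (mul_ne_zero h1.1 h1.2.1) h2
  · by_contra hne
    exact hi' ⟨(i, n - i), Finset.mem_coe.2 (Finset.mem_antidiagonal.2
      ⟨left_ne_zero_of_mul hne, right_ne_zero_of_mul hne, by simp⟩), rfl⟩
  · have h1 := (Finset.mem_antidiagonal.1 hp).2.2
    rw [show n - p.1 = p.2 by omega]
    rfl

theorem Laurent.exists_coeff_eq_zero (a : Laurent) : ∃ N : ℤ, ∀ n < N, a.coeff n = 0 := by
  by_cases h : a = 0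
  · exact ⟨0, fun n _ => by rw [h, Laurent.coeff_zero]⟩
  · exact ⟨HahnSeries.order (a : LaurentSeries ℂ), fun n hn => HahnSeries.coeff_eq_zero_of_lt_order hn⟩

/-- The polar Laurent series, as a subspace. -/
def polarPart : Submodule ℂ Laurent where
  carrier := {a | IsPolar a}
  add_mem' ha hb n hn := by rw [Laurent.coeff_add, ha n hn, hb n hn, add_zero]
  zero_mem' _ _ := rfl
  smul_mem' c a ha n hn := by rw [Laurent.coeff_smul, ha n hn, mul_zero]

/-- The holomorphic Laurent series, as a subspace. -/
def holoPart : Submodule ℂ Laurent where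
  carrier := {a | IsHolo a}
  add_mem' ha hb n hn := by rw [Laurent.coeff_add, ha n hn, hb n hn, add_zero]
  zero_mem' _ _ := rfl
  smul_mem' c a ha n hn := by rw [Laurent.coeff_smul, ha n hn, mul_zero]

theorem IsPolar.mul {a b : Laurent} (ha : IsPolar a) (hb : IsPolar b) : IsPolar (a * b) :=
  fun n hn => by
    refine (Laurent.coeff_mul_eq_sum a b n ∅ fun i _ => ?_).trans Finset.sum_empty
    rcases le_or_gt 0 i with h | h
    · rw [ha i h, zero_mul]
    · rw [hb _ (by omega), mul_zero]

theorem IsHolo.mul {a b : Laurent} (ha : IsHolo a) (hb : IsHolo b) : IsHolo (a * b) :=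
  fun n hn => by
    refine (Laurent.coeff_mul_eq_sum a b n ∅ fun i _ => ?_).trans Finset.sum_empty
    rcases lt_or_ge i 0 with h | h
    · rw [ha i h, zero_mul]
    · rw [hb _ (by omega), mul_zero]

theorem isHolo_algebraMap (c : ℂ) : IsHolo (algebraMap ℂ Laurent c) := fun n hn => by
  rw [Laurent.coeff_algebraMap, if_neg hn.ne]

theorem isHolo_one : IsHolo 1 := by
  have h := isHolo_algebraMap 1
  rwa [map_one] at h

theorem isPolar_Pminus (a : Laurent) : IsPolar (Pminus a) := fun n hn => by
  rw [coeff_Pminus, if_neg hn.not_gt]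

theorem coeff_Pplus (a : Laurent) (n : ℤ) :
    (Pplus a).coeff n = if n < 0 then 0 else a.coeff n := by
  have h : Pplus a + Pminus a = a := by simp [Pplus]
  have h' := congrArg (fun b => Laurent.coeff b n) h
  simp only [Laurent.coeff_add, coeff_Pminus] at h'
  split_ifs with hn <;> simp_all

theorem isHolo_Pplus (a : Laurent) : IsHolo (Pplus a) := fun n hn => by
  rw [coeff_Pplus, if_pos hn]

theorem IsPolar.eq_zero_of_isHolo {a : Laurent} (ha : IsPolar a) (ha' : IsHolo a) : a = 0 :=
  Laurent.ext fun n => by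
    rcases lt_or_ge n 0 with h | h
    · exact ha' n h
    · exact ha n h

theorem isSplitting_Pminus : IsSplitting Pminus polarPart holoPart where
  mem_left := isPolar_Pminus
  mem_right b := isHolo_Pplus b
  disjoint _ := IsPolar.eq_zero_of_isHolo
  mul_left _ ha _ hb := IsPolar.mul ha hb
  mul_right _ ha _ hb := IsHolo.mul ha hb
  one_mem := isHolo_one

theorem IsPolar.Pplus_eq_zero {a : Laurent} (ha : IsPolar a) : Pplus a = 0 :=
  Laurent.ext fun n => by
    rw [coeff_Pplus]
    split_ifs with h
    · rfl
    · exact ha n (not_lt.1 h)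

theorem IsHolo.Pplus_eq_self {a : Laurent} (ha : IsHolo a) : Pplus a = a :=
  Laurent.ext fun n => by
    rw [coeff_Pplus]
    split_ifs with h
    · exact (ha n h).symm
    · rfl

/-- The inverse of the variable `λ`. -/
def lamInv : Laurent := (HahnSeries.single (-1) 1 : LaurentSeries ℂ)

theorem lam_mul_lamInv : lam * lamInv = 1 :=
  (HahnSeries.single_mul_single (Γ := ℤ) (R := ℂ)).trans (by rw [mul_one]; rfl)

theorem coeff_lam_mul (a : Laurent) (n : ℤ) : (lam * a).coeff n = a.coeff (n - 1) := by
  have h := HahnSeries.coeff_single_mul_add (Γ := ℤ) (r := (1 : ℂ)) (x := a) (a := n - 1) (b := 1)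
  rw [sub_add_cancel, one_mul] at h
  exact h

/-! ### Birkhoff decompositions of characters -/

section Characters

variable {H : Type*} [CommRing H] [HopfAlgebra ℂ H]

/-- `g` maps the augmentation ideal to polar Laurent series. -/
def Chr.IsPolar (g : Chr H) : Prop := ∀ x, counit (R := ℂ) x = 0 → LaxBeta.IsPolar (g x)

theorem Chr.inv_apply (g : Chr H) (x : H) : g⁻¹ x = g (HopfAlgebraStruct.antipode ℂ x) := rfl

theorem Chr.lin_mul_lin_inv (g : Chr H) : g.lin * g⁻¹.lin = 1 := by
  rw [← Chr.lin_mul, mul_inv_cancel, Chr.lin_one]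

theorem Chr.lin_inv_mul_lin (g : Chr H) : g⁻¹.lin * g.lin = 1 := by
  rw [← Chr.lin_mul, inv_mul_cancel, Chr.lin_one]

theorem convMul_mem_of_forall {B : Type*} [CommRing B] [Algebra ℂ B] (S : Submodule ℂ B)
    {p q : WithConv (H →ₗ[ℂ] B)} (h : ∀ a b, p a * q b ∈ S) (x : H) : (p * q) x ∈ S := by
  rw [(ℛ ℂ x).convMul_apply]
  exact sum_mem fun i _ => h _ _

/-- The working form of polarity: after subtracting `ε` it holds on all of `H`, so it can be used
inside convolutions. -/
theorem Chr.IsPolar.sub_one {g : Chr H} (hg : g.IsPolar) (x : H) :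
    (g.lin - 1) x ∈ polarPart := by
  have h := hg (x - algebraMap ℂ H (counit (R := ℂ) x)) (by simp)
  rw [map_sub, AlgHom.commutes] at h
  exact h

theorem Chr.IsPolar.mul {g k : Chr H} (hg : g.IsPolar) (hk : k.IsPolar) : (g * k).IsPolar := by
  intro x hx
  have e : (g * k).lin = (g.lin - 1) * (k.lin - 1) + (g.lin - 1) + (k.lin - 1) + 1 := by
    rw [Chr.lin_mul]; noncomm_ring
  have e' : (g * k) x = ((g.lin - 1) * (k.lin - 1)) x + (g.lin - 1) x + (k.lin - 1) x +
      (1 : WithConv (H →ₗ[ℂ] Laurent)) x := congrArg (fun p : WithConv (H →ₗ[ℂ] Laurent) => p x) e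
  rw [e', LinearMap.convOne_apply, hx, map_zero, add_zero]
  exact add_mem (add_mem (convMul_mem_of_forall polarPart
    (fun a b => LaxBeta.IsPolar.mul (hg.sub_one a) (hk.sub_one b)) x) (hg.sub_one x)) (hk.sub_one x)

theorem Chr.IsPolar.inv {g : Chr H} (hg : g.IsPolar) : g⁻¹.IsPolar := fun x hx => by
  rw [Chr.inv_apply]
  exact hg _ (by rw [HopfAlgebra.counit_antipode, hx])

theorem Chr.isHolo_mul {g k : Chr H} (hg : ∀ x, IsHolo (g x)) (hk : ∀ x, IsHolo (k x)) (x : H) :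
    IsHolo ((g * k) x) :=
  convMul_mem_of_forall (p := g.lin) (q := k.lin) holoPart
    (fun a b => IsHolo.mul (hg a) (hk b)) x

theorem Chr.isHolo_inv {g : Chr H} (hg : ∀ x, IsHolo (g x)) (x : H) : IsHolo (g⁻¹ x) := by
  rw [Chr.inv_apply]
  exact hg _

/-- `gm ⋆ gm'⁻¹ = gp ⋆ gp'⁻¹` is both polar and holomorphic, hence the unit. -/
theorem IsBirkhoff.unique {g gm gp gm' gp' : Chr H} (h : IsBirkhoff g gm gp)
    (h' : IsBirkhoff g gm' gp') : gm = gm' := by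
  have e : gm * gm'⁻¹ = gp * gp'⁻¹ := by
    have := h.eq.symm.trans h'.eq
    rw [inv_mul_eq_iff_eq_mul] at this
    rw [this]
    group
  have h1 : gm * gm'⁻¹ = 1 := by
    apply Chr.lin_injective
    refine WithConv.ext (LinearMap.ext fun x => ?_)
    have hp : (gm * gm'⁻¹).IsPolar := Chr.IsPolar.mul h.polar (Chr.IsPolar.inv h'.polar)
    have hz : ((gm * gm'⁻¹).lin - 1) x = 0 := by
      refine (hp.sub_one x).eq_zero_of_isHolo ?_
      refine holoPart.sub_mem ?_ (isHolo_algebraMap _)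
      rw [e]
      exact Chr.isHolo_mul h.holo (Chr.isHolo_inv h'.holo) x
    exact sub_eq_zero.1 hz
  exact mul_inv_eq_one.1 h1

theorem IsBirkhoff.negPart_eq {g gm gp : Chr H} (h : IsBirkhoff g gm gp) : negPart g = gm := by
  have hex : ∃ p : Chr H × Chr H, IsBirkhoff g p.1 p.2 := ⟨(gm, gp), h⟩
  rw [negPart, dif_pos hex]
  exact hex.choose_spec.unique h

theorem exists_isBirkhoff (𝓗 : ℕ → Submodule ℂ H) [GradedAlgebra 𝓗] [IsConnectedGraded 𝓗]
    (g : Chr H) : ∃ gp, IsBirkhoff g (negPart g) gp := by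
  obtain ⟨k, hk, hk'⟩ := exists_birkhoff 𝓗 isSplitting_Pminus g.ofConv
  have h : IsBirkhoff g (toConv k) (toConv k * g) := ⟨by group, hk, hk'⟩
  rw [h.negPart_eq]
  exact ⟨_, h⟩

end Characters

/-! ### The scattering map and locality -/

section LinearOperations

variable {H : Type*} [CommRing H] [HopfAlgebra ℂ H] {B : Type*} [CommRing B] [Algebra ℂ B]

/-- Multiplication of the values by a fixed element. -/
def scale (b : B) (p : WithConv (H →ₗ[ℂ] B)) : WithConv (H →ₗ[ℂ] B) :=
  toConv (LinearMap.mulLeft ℂ b ∘ₗ p.ofConv)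

theorem scale_apply (b : B) (p : WithConv (H →ₗ[ℂ] B)) (x : H) : scale b p x = b * p x := rfl

theorem scale_neg (b : B) (p : WithConv (H →ₗ[ℂ] B)) : scale b (-p) = -scale b p := by
  ext x
  change b * -(p x) = -(b * p x)
  ring

theorem scale_mul (b : B) (p q : WithConv (H →ₗ[ℂ] B)) : scale b p * q = scale b (p * q) := by
  ext x
  rw [(ℛ ℂ x).convMul_apply, scale_apply, (ℛ ℂ x).convMul_apply, Finset.mul_sum]
  exact Finset.sum_congr rfl fun i _ => by rw [scale_apply, mul_assoc]

theorem mul_scale (b : B) (p q : WithConv (H →ₗ[ℂ] B)) : p * scale b q = scale b (p * q) := by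
  ext x
  rw [(ℛ ℂ x).convMul_apply, scale_apply, (ℛ ℂ x).convMul_apply, Finset.mul_sum]
  exact Finset.sum_congr rfl fun i _ => by rw [scale_apply, mul_left_comm]

theorem scale_scale (b c : B) (p : WithConv (H →ₗ[ℂ] B)) :
    scale b (scale c p) = scale (b * c) p := by
  ext x
  exact (mul_assoc b c (p x)).symm

theorem scale_one (p : WithConv (H →ₗ[ℂ] B)) : scale 1 p = p := by
  ext x
  exact one_mul (p x)

theorem scale_lam_lamInv (p : WithConv (H →ₗ[ℂ] Laurent)) : scale lam (scale lamInv p) = p := by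
  rw [scale_scale, lam_mul_lamInv, scale_one]

theorem scale_lamInv_lam (p : WithConv (H →ₗ[ℂ] Laurent)) : scale lamInv (scale lam p) = p := by
  rw [scale_scale, mul_comm, lam_mul_lamInv, scale_one]

theorem IsTangent.scale {Z : WithConv (H →ₗ[ℂ] B)} (hZ : IsTangent 1 Z) (b : B) :
    IsTangent 1 (scale b Z) := fun x y => by
  rw [scale_apply, scale_apply, scale_apply, hZ]
  ring

variable (𝓗 : ℕ → Submodule ℂ H) [GradedAlgebra 𝓗]

/-- Precomposition with the degree derivation. -/
def compDeg (p : WithConv (H →ₗ[ℂ] B)) : WithConv (H →ₗ[ℂ] B) := toConv (p.ofConv ∘ₗ degOp 𝓗)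

theorem compDeg_of_mem (p : WithConv (H →ₗ[ℂ] B)) {n : ℕ} {x : H} (hx : x ∈ 𝓗 n) :
    compDeg 𝓗 p x = (n : ℂ) • p x := by
  change p (degOp 𝓗 x) = _
  rw [degOp_of_mem 𝓗 hx, map_smul]

variable {𝓗}

theorem withConv_ext_of_homogeneous {p q : WithConv (H →ₗ[ℂ] B)}
    (h : ∀ n, ∀ x ∈ 𝓗 n, p x = q x) : p = q :=
  WithConv.ext (linearMap_ext_of_homogeneous 𝓗 h)

/-- A property of values which is stable under addition may be checked on homogeneous elements. -/
theorem apply_mem_of_homogeneous (S : Submodule ℂ B) {p : WithConv (H →ₗ[ℂ] B)}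
    (h : ∀ n, ∀ x ∈ 𝓗 n, p x ∈ S) (x : H) : p x ∈ S := by
  induction x using DirectSum.Decomposition.inductionOn 𝓗 with
  | zero => rw [map_zero]; exact zero_mem S
  | add a b ha hb => rw [map_add]; exact add_mem ha hb
  | @homogeneous m a => exact h m a a.2

variable [IsConnectedGraded 𝓗]

/-- `Y` is a coderivation because the coproduct preserves the total degree. -/
theorem compDeg_mul (p q : WithConv (H →ₗ[ℂ] B)) :
    compDeg 𝓗 (p * q) = compDeg 𝓗 p * q + p * compDeg 𝓗 q := by
  refine withConv_ext_of_homogeneous (𝓗 := 𝓗) fun n x hx => ?_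
  obtain ⟨k, r, hr⟩ := exists_homogeneous_repr hx
  rw [compDeg_of_mem 𝓗 _ hx, ofConv_add, LinearMap.add_apply, r.convMul_apply, r.convMul_apply,
    r.convMul_apply, Finset.smul_sum, ← Finset.sum_add_distrib]
  refine Finset.sum_congr rfl fun i _ => ?_
  obtain ⟨a, b, rfl, ha, hb⟩ := hr i
  rw [compDeg_of_mem 𝓗 _ ha, compDeg_of_mem 𝓗 _ hb, smul_mul_assoc, mul_smul_comm, ← add_smul,
    Nat.cast_add]

theorem compDeg_one : compDeg 𝓗 (1 : WithConv (H →ₗ[ℂ] B)) = 0 := by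
  ext x
  change (1 : WithConv (H →ₗ[ℂ] B)) (degOp 𝓗 x) = 0
  rw [LinearMap.convOne_apply, counit_degOp, map_zero]

end LinearOperations

/-! ### The twist `φˢ` and its infinitesimal generator. -/

section Twist

variable {H : Type*} [CommRing H] [HopfAlgebra ℂ H] (𝓗 : ℕ → Submodule ℂ H) [GradedAlgebra 𝓗]

/-- The twist of a linear map, `p(x) ↦ e^{sλ|x|} p(x)`. -/
def twistLin (s : ℂ) (p : WithConv (H →ₗ[ℂ] Laurent)) : WithConv (H →ₗ[ℂ] Laurent) :=
  toConv (degreewise 𝓗 fun n => LinearMap.mulLeft ℂ (expLam (s * n)) ∘ₗ p.ofConv)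

theorem twistLin_of_mem (s : ℂ) (p : WithConv (H →ₗ[ℂ] Laurent)) {n : ℕ} {x : H} (hx : x ∈ 𝓗 n) :
    twistLin 𝓗 s p x = expLam (s * n) * p x :=
  degreewise_of_mem 𝓗 _ hx

theorem lin_twist (φ : Chr H) (s : ℂ) : (twist 𝓗 φ s).lin = twistLin 𝓗 s φ.lin :=
  withConv_ext_of_homogeneous (𝓗 := 𝓗) fun n x hx => by
    rw [twistLin_of_mem 𝓗 s _ hx]
    exact twist_of_mem 𝓗 φ s hx

theorem twistLin_zero (p : WithConv (H →ₗ[ℂ] Laurent)) : twistLin 𝓗 0 p = p :=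
  withConv_ext_of_homogeneous (𝓗 := 𝓗) fun n x hx => by
    rw [twistLin_of_mem 𝓗 0 _ hx, zero_mul, expLam_zero, one_mul]

theorem twist_zero (φ : Chr H) : twist 𝓗 φ 0 = φ :=
  Chr.lin_injective (by rw [lin_twist, twistLin_zero])

theorem coeff_expLam (c : ℂ) (k : ℤ) :
    (expLam c).coeff k = if k < 0 then 0 else c ^ k.toNat * ((k.toNat).factorial : ℂ)⁻¹ := by
  have h := PowerSeries.coeff_coe (PowerSeries.rescale c (PowerSeries.exp ℂ)) k
  refine h.trans ?_
  split_ifs with hk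
  · rfl
  · rw [PowerSeries.coeff_rescale, PowerSeries.coeff_exp]
    have : k.natAbs = k.toNat := by omega
    simp [this]

theorem isHolo_expLam (c : ℂ) : IsHolo (expLam c) := fun k hk => by
  rw [coeff_expLam, if_pos hk]

theorem twistLin_isHolo {p : WithConv (H →ₗ[ℂ] Laurent)} (hp : ∀ x, IsHolo (p x)) (s : ℂ) (x : H) :
    IsHolo (twistLin 𝓗 s p x) :=
  apply_mem_of_homogeneous (𝓗 := 𝓗) holoPart (fun n x hx => by
    rw [twistLin_of_mem 𝓗 s p hx]
    exact IsHolo.mul (isHolo_expLam _) (hp x)) x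

/-- Each coefficient is a monomial in `s`; differentiating lowers its exponent by one, which is the
coefficient shift made by `λ`. -/
theorem hasDerivAt_coeff_expLam (c s : ℂ) (k : ℤ) :
    HasDerivAt (fun s => (expLam (s * c)).coeff k) ((lam * (c • expLam (s * c))).coeff k) s := by
  simp only [coeff_lam_mul, Laurent.coeff_smul, coeff_expLam]
  rcases lt_or_ge k 0 with hk | hk
  · simp only [if_pos hk, if_pos (show k - 1 < 0 by omega), mul_zero]
    exact hasDerivAt_const _ _
  lift k to ℕ using hk
  simp only [if_neg (show ¬ ((k : ℤ) < 0) by omega), Int.toNat_natCast]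
  have h := (((hasDerivAt_id s).mul_const c).pow k).mul_const ((k.factorial : ℂ)⁻¹)
  refine h.congr_deriv ?_
  rcases k with _ | k
  · simp
  · rw [if_neg (by omega), show ((k + 1 : ℕ) : ℤ) - 1 = k by omega, Int.toNat_natCast,
      Nat.factorial_succ]
    have h1 : ((k : ℂ) + 1) ≠ 0 := Nat.cast_add_one_ne_zero k
    have h2 : ((k.factorial : ℕ) : ℂ) ≠ 0 := Nat.cast_ne_zero.2 k.factorial_ne_zero
    push_cast
    simp only [id_eq, one_mul]
    field_simp

/-- Multiplication by a fixed Laurent series commutes with coefficientwise derivatives of families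
of power series. -/
theorem hasDerivAt_coeff_mul (a : Laurent) {b : ℂ → Laurent} {b' : Laurent} {s : ℂ}
    (hb : ∀ s, IsHolo (b s)) (hb' : IsHolo b')
    (h : ∀ k, HasDerivAt (fun s => (b s).coeff k) (b'.coeff k) s) (k : ℤ) :
    HasDerivAt (fun s => (a * b s).coeff k) ((a * b').coeff k) s := by
  obtain ⟨N, hN⟩ := a.exists_coeff_eq_zero
  -- For holomorphic `c` the indices `N ≤ i ≤ k` suffice, a range independent of `s`.
  have key : ∀ c : Laurent, IsHolo c →
      (a * c).coeff k = ∑ i ∈ Finset.Icc N k, a.coeff i * c.coeff (k - i) := fun c hc => by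
    refine Laurent.coeff_mul_eq_sum a c k _ fun i hi => ?_
    rcases lt_or_ge i N with h | h
    · rw [hN i h, zero_mul]
    · rw [hc _ (by rw [Finset.mem_Icc] at hi; omega), mul_zero]
  simp only [fun s => key _ (hb s), key _ hb']
  exact HasDerivAt.fun_sum fun i _ => (h (k - i)).const_mul _

theorem hasDerivAt_coeff_mul_twistLin (a : Laurent) (q : WithConv (H →ₗ[ℂ] Laurent)) (x : H)
    (s : ℂ) (k : ℤ) :
    HasDerivAt (fun s => (a * twistLin 𝓗 s q x).coeff k)
      ((a * twistLin 𝓗 s (scale lam (compDeg 𝓗 q)) x).coeff k) s := by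
  induction x using DirectSum.Decomposition.inductionOn 𝓗 with
  | zero => simpa using hasDerivAt_const s (0 : ℂ)
  | add x y hx hy =>
    simp only [map_add, mul_add, Laurent.coeff_add]
    exact hx.add hy
  | @homogeneous n x =>
    have h := hasDerivAt_coeff_mul (a * q x) (b := fun s => expLam (s * n))
      (b' := lam * ((n : ℂ) • expLam (s * n))) (fun s => isHolo_expLam (s * n)) (fun j hj => by
        rw [coeff_lam_mul, Laurent.coeff_smul, isHolo_expLam _ _ (by omega), mul_zero])
      (hasDerivAt_coeff_expLam (n : ℂ) s) k
    have e1 : ∀ s, a * twistLin 𝓗 s q x = a * q x * expLam (s * n) := fun s => by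
      rw [twistLin_of_mem 𝓗 _ _ x.2]
      ring
    have e2 : a * twistLin 𝓗 s (scale lam (compDeg 𝓗 q)) x =
        a * q x * (lam * ((n : ℂ) • expLam (s * n))) := by
      rw [twistLin_of_mem 𝓗 _ _ x.2, scale_apply, compDeg_of_mem 𝓗 _ x.2, mul_smul_comm,
        mul_smul_comm, mul_smul_comm, mul_smul_comm, mul_smul_comm]
      congr 1
      ring
    simp only [e1, e2]
    exact h

/-- The generator of the twist is `q ↦ λ (q ∘ Y)`. This links locality, which is stated with `φˢ`,
to `λR̃`. -/
theorem hasDerivAt_coeff_convMul_twistLin (p q : WithConv (H →ₗ[ℂ] Laurent)) (x : H) (s : ℂ)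
    (k : ℤ) :
    HasDerivAt (fun s => ((p * twistLin 𝓗 s q) x).coeff k)
      (((p * twistLin 𝓗 s (scale lam (compDeg 𝓗 q))) x).coeff k) s := by
  have hsum : ∀ c : WithConv (H →ₗ[ℂ] Laurent), ((p * c) x).coeff k =
      ∑ i ∈ (ℛ ℂ x).index, (p ((ℛ ℂ x).left i) * c ((ℛ ℂ x).right i)).coeff k := fun c => by
    rw [(ℛ ℂ x).convMul_apply]
    exact map_sum (coeffL k) _ _
  simp only [hsum]
  exact HasDerivAt.fun_sum fun i _ => hasDerivAt_coeff_mul_twistLin 𝓗 _ q _ s k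

variable [IsConnectedGraded 𝓗]

theorem twistLin_mul (s : ℂ) (p q : WithConv (H →ₗ[ℂ] Laurent)) :
    twistLin 𝓗 s (p * q) = twistLin 𝓗 s p * twistLin 𝓗 s q := by
  refine withConv_ext_of_homogeneous (𝓗 := 𝓗) fun n x hx => ?_
  obtain ⟨k, r, hr⟩ := exists_homogeneous_repr hx
  rw [twistLin_of_mem 𝓗 _ _ hx, r.convMul_apply, r.convMul_apply, Finset.mul_sum]
  refine Finset.sum_congr rfl fun i _ => ?_
  obtain ⟨a, b, rfl, ha, hb⟩ := hr i
  rw [twistLin_of_mem 𝓗 _ _ ha, twistLin_of_mem 𝓗 _ _ hb, Nat.cast_add, mul_add, expLam_add]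
  ring

theorem twist_mul (φ ψ : Chr H) (s : ℂ) : twist 𝓗 (φ * ψ) s = twist 𝓗 φ s * twist 𝓗 ψ s :=
  Chr.lin_injective (by
    rw [lin_twist, Chr.lin_mul, Chr.lin_mul, twistLin_mul, lin_twist, lin_twist])

end Twist

/-! ### Characters with constant `λR̃`, locality and the `β`-function. -/

section Scattering

variable {H : Type*} [CommRing H] [HopfAlgebra ℂ H] {𝓗 : ℕ → Submodule ℂ H} [GradedAlgebra 𝓗]

/-- Multiplying by `ζ` removes the inverse and leaves an equation linear in `ζ`, which can be solved
by recursion on the degree. -/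
theorem lamRtilde_eq_iff {ζ : Chr H} {Z : InfChar H Laurent} :
    lamRtilde 𝓗 ζ = Z ↔ scale lam (compDeg 𝓗 ζ.lin) = ζ.lin * Z.1 := by
  have hval : (lamRtilde 𝓗 ζ).1 = ζ⁻¹.lin * scale lam (compDeg 𝓗 ζ.lin) := by
    rw [mul_scale]
    rfl
  rw [← Subtype.coe_inj, hval]
  constructor
  · intro h
    rw [← h, ← mul_assoc, Chr.lin_mul_lin_inv, one_mul]
  · intro h
    rw [h, ← mul_assoc, Chr.lin_inv_mul_lin, one_mul]

theorem Chr.isPolar_of_homogeneous {g : Chr H}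
    (h : ∀ n, ∀ x ∈ 𝓗 n, (g.lin - 1) x ∈ polarPart) : g.IsPolar := fun x hx => by
  have h' := apply_mem_of_homogeneous (𝓗 := 𝓗) polarPart h x
  change g x - (1 : WithConv (H →ₗ[ℂ] Laurent)) x ∈ polarPart at h'
  rwa [LinearMap.convOne_apply, hx, map_zero, sub_zero] at h'

variable [IsConnectedGraded 𝓗]

variable (𝓗) in
/-- `λR̃` is surjective. -/
theorem exists_lamRtilde_eq (Z : InfChar H Laurent) : ∃ ζ : Chr H, lamRtilde 𝓗 ζ = Z := by
  set W := scale lamInv Z.1 with hW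
  have hWt : IsTangent 1 W := IsTangent.scale (mem_infChar.1 Z.2) _
  -- The inverse of `Y` in positive degree. In degree zero `(0 : ℂ)⁻¹ = 0`, which leaves `g = ε`
  -- there.
  let Yinv : H →ₗ[ℂ] H := degreewise 𝓗 fun n => (n : ℂ)⁻¹ • LinearMap.id
  have hYinv : ∀ n, ∀ x ∈ 𝓗 n, Yinv x = (n : ℂ)⁻¹ • x := fun n x hx => degreewise_of_mem 𝓗 _ hx
  let K : WithConv (H →ₗ[ℂ] Laurent) →+ WithConv (H →ₗ[ℂ] Laurent) :=
    AddMonoidHom.mk' (fun g => toConv ((g * W).ofConv ∘ₗ Yinv)) fun g g' => by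
      rw [add_mul, ofConv_add, LinearMap.add_comp, toConv_add]
  have hK : ∀ g n, ∀ x ∈ 𝓗 n, K g x = (n : ℂ)⁻¹ • (g * W) x := fun g n x hx => by
    change (g * W) (Yinv x) = _
    rw [hYinv n x hx, map_smul]
  obtain ⟨g, hg⟩ := exists_eq_add_of_raises 𝓗 K (fun n g hg i hi x hx => by
    rw [hK g i x hx, hg.mul_succ hWt.apply_one i hi x hx, smul_zero]) 1
  have hgx : ∀ n, ∀ x ∈ 𝓗 n,
      g x = algebraMap ℂ Laurent (counit (R := ℂ) x) + (n : ℂ)⁻¹ • (g * W) x := fun n x hx => by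
    conv_lhs => rw [hg]
    change (1 : WithConv (H →ₗ[ℂ] Laurent)) x + K g x = _
    rw [LinearMap.convOne_apply, hK g n x hx]
  have hdeg : compDeg 𝓗 g = g * W := withConv_ext_of_homogeneous (𝓗 := 𝓗) fun n x hx => by
    rw [compDeg_of_mem 𝓗 _ hx]
    rcases Nat.eq_zero_or_pos n with rfl | hn
    · rw [Nat.cast_zero, zero_smul]
      refine (apply_eq_zero_of_mem_zero ?_ hx).symm
      rw [convMul_apply_one, hWt.apply_one, mul_zero]
    · rw [hgx n x hx, IsConnectedGraded.counit_eq_zero (𝓗 := 𝓗) n hn x hx, map_zero, zero_add,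
        smul_smul, mul_inv_cancel₀ (Nat.cast_ne_zero.2 hn.ne'), one_smul]
  have hg1 : g 1 = 1 := by
    rw [hgx 0 1 SetLike.GradedOne.one_mem]
    simp
  -- The Leibniz rule reads `(m + n) g(xy) = (m + n) g(x) g(y)`, and `m + n` is cancelled.
  have hgm : IsMult g := isMult_of_pos_degree (𝓗 := 𝓗) hg1 fun m n hm hn ih x hx y hy => by
    have h := convMul_tangent_leibniz hx hy hWt ih
    rw [← hdeg, compDeg_of_mem 𝓗 _ (SetLike.mul_mem_graded hx hy), compDeg_of_mem 𝓗 _ hx,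
      compDeg_of_mem 𝓗 _ hy, smul_mul_assoc, mul_smul_comm, ← add_smul, ← Nat.cast_add] at h
    exact sub_eq_zero.2 (smul_right_injective _ (Nat.cast_ne_zero.2 (by omega)) h)
  refine ⟨toConv (AlgHom.ofLinearMap g.ofConv hg1 hgm), lamRtilde_eq_iff.2 ?_⟩
  change scale lam (compDeg 𝓗 g) = g * Z.1
  rw [hdeg, hW, mul_scale, scale_lam_lamInv]

/-- `λR̃` is injective. -/
theorem lamRtilde_injective : Function.Injective (lamRtilde (H := H) 𝓗) := by
  intro ζ ξ h
  have h1 := lamRtilde_eq_iff.1 (rfl : lamRtilde 𝓗 ξ = lamRtilde 𝓗 ξ)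
  have h2 := lamRtilde_eq_iff.1 h
  set Z := lamRtilde 𝓗 ξ
  have hW : scale lamInv Z.1 1 = 0 := ((mem_infChar.1 Z.2).scale lamInv).apply_one
  -- The difference solves the same linear equation. The right side vanishes one degree further than
  -- the difference does, so the order of vanishing grows without bound.
  have hd : compDeg 𝓗 (ζ.lin - ξ.lin) = (ζ.lin - ξ.lin) * scale lamInv Z.1 := by
    have e : compDeg 𝓗 (ζ.lin - ξ.lin) = compDeg 𝓗 ζ.lin - compDeg 𝓗 ξ.lin := rfl
    rw [e, sub_mul, mul_scale, mul_scale, ← h1, ← h2, scale_lamInv_lam, scale_lamInv_lam]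
  apply Chr.lin_injective
  refine eq_of_vanishesBelow_sub (𝓗 := 𝓗) fun N => ?_
  induction N with
  | zero => exact vanishesBelow_zero _
  | succ N ih =>
    intro i hi x hx
    have h := ih.mul_succ hW i hi x hx
    rw [← hd, compDeg_of_mem 𝓗 _ hx] at h
    rcases Nat.eq_zero_or_pos i with rfl | hpos
    · refine apply_eq_zero_of_mem_zero ?_ hx
      change ζ 1 - ξ 1 = 0
      rw [map_one, map_one, sub_self]
    · exact (smul_eq_zero.1 h).resolve_left (Nat.cast_ne_zero.2 hpos.ne')

theorem const_apply (b : InfChar H ℂ) (x : H) :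
    (InfChar.const b).1 x = algebraMap ℂ Laurent (b.1 x) := rfl

/-- In degree `n`, `n ζ(x)` is the value of `ζ ⋆ λ⁻¹b`, which involves `ζ` only in lower degrees.
Since `λ⁻¹b` is polar and polar series are closed under products, induction applies. -/
theorem Chr.isPolar_of_lamRtilde_eq_const {ζ : Chr H} {b : InfChar H ℂ}
    (h : lamRtilde 𝓗 ζ = InfChar.const b) : ζ.IsPolar := by
  have hdeg : compDeg 𝓗 ζ.lin = ζ.lin * scale lamInv (InfChar.const b).1 := by
    rw [mul_scale, ← lamRtilde_eq_iff.1 h, scale_lamInv_lam]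
  have hW : ∀ x, scale lamInv (InfChar.const b).1 x ∈ polarPart := fun x n hn => by
    have e : (algebraMap ℂ Laurent (b.1 x)).coeff (n + 1) =
        (lam * scale lamInv (InfChar.const b).1 x).coeff (n + 1) := by
      rw [← scale_apply, scale_lam_lamInv, const_apply]
    rw [coeff_lam_mul, add_sub_cancel_right, Laurent.coeff_algebraMap, if_neg (by omega)] at e
    exact e.symm
  refine Chr.isPolar_of_homogeneous (𝓗 := 𝓗) fun n => ?_
  induction n using Nat.strong_induction_on with
  | _ n ih =>
    intro x hx
    rcases Nat.eq_zero_or_pos n with rfl | hn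
    · rw [apply_eq_zero_of_mem_zero ?_ hx]
      · exact zero_mem _
      · change ζ 1 - (1 : WithConv (H →ₗ[ℂ] Laurent)) 1 = 0
        simp
    · have hmem : (compDeg 𝓗 ζ.lin) x ∈ polarPart := by
        rw [hdeg]
        refine convMul_mem _ hx fun i j hij a ha c hc => ?_
        rcases Nat.eq_zero_or_pos j with rfl | hj
        · rw [apply_eq_zero_of_mem_zero
            ((mem_infChar.1 (InfChar.const b).2).scale lamInv).apply_one hc, mul_zero]
          exact zero_mem _
        · have e : ζ.lin a = (ζ.lin - 1) a + counit (R := ℂ) a • 1 := by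
            rw [← Algebra.algebraMap_eq_smul_one]
            exact (sub_add_cancel _ _).symm
          rw [e, add_mul, smul_mul_assoc, one_mul]
          exact add_mem (LaxBeta.IsPolar.mul (ih i (by omega) a ha) (hW c))
            (polarPart.smul_mem _ (hW c))
      rw [compDeg_of_mem 𝓗 _ hx] at hmem
      have e : (ζ.lin - 1) x = (n : ℂ)⁻¹ • (n : ℂ) • ζ.lin x := by
        rw [smul_smul, inv_mul_cancel₀ (Nat.cast_ne_zero.2 hn.ne'), one_smul]
        change ζ.lin x - (1 : WithConv (H →ₗ[ℂ] Laurent)) x = _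
        rw [LinearMap.convOne_apply, IsConnectedGraded.counit_eq_zero (𝓗 := 𝓗) n hn x hx, map_zero,
          sub_zero]
      rw [e]
      exact polarPart.smul_mem _ hmem

omit [IsConnectedGraded 𝓗] in
-- The decomposition is `ζ = (ζ⁻¹)⁻¹ ⋆ ε`.
theorem Chr.IsPolar.negPart_eq_inv {ζ : Chr H} (h : ζ.IsPolar) : negPart ζ = ζ⁻¹ :=
  IsBirkhoff.negPart_eq (gp := 1) ⟨by group, h.inv, fun _ => isHolo_algebraMap _⟩

theorem Chr.IsPolar.coeff_zero {g : Chr H} (hg : g.IsPolar) (x : H) :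
    (g x).coeff 0 = counit (R := ℂ) x := by
  have h := hg.sub_one x 0 le_rfl
  have e : (g.lin - 1) x + algebraMap ℂ Laurent (counit (R := ℂ) x) = g x := sub_add_cancel _ _
  rw [← e, Laurent.coeff_add, h, Laurent.coeff_algebraMap, if_pos rfl, zero_add]

/-- Here `ζ₋ = ζ⁻¹`, and applying `Y` to `ζ⁻¹ ⋆ ζ = ε` gives `λ (ζ⁻¹ ∘ Y) = -b ⋆ ζ⁻¹`. The constant
coefficient on the left is the residue of `ζ⁻¹ ∘ Y`; on the right it is `-b`, since a polar
character has constant coefficient `ε`. -/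
theorem betaFun_eq_of_lamRtilde_eq_const {ζ : Chr H} {b : InfChar H ℂ}
    (h : lamRtilde 𝓗 ζ = InfChar.const b) : betaFun 𝓗 ζ = b := by
  have hζ := Chr.isPolar_of_lamRtilde_eq_const h
  have hinv : scale lam (compDeg 𝓗 ζ⁻¹.lin) = -((InfChar.const b).1 * ζ⁻¹.lin) := by
    have h1 := compDeg_mul (𝓗 := 𝓗) ζ⁻¹.lin ζ.lin
    rw [Chr.lin_inv_mul_lin, compDeg_one] at h1
    have h2 : compDeg 𝓗 ζ⁻¹.lin = -(ζ⁻¹.lin * compDeg 𝓗 ζ.lin * ζ⁻¹.lin) := by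
      rw [← mul_one (compDeg 𝓗 ζ⁻¹.lin), ← Chr.lin_mul_lin_inv ζ, ← mul_assoc,
        eq_neg_of_add_eq_zero_left h1.symm, neg_mul]
    rw [h2, scale_neg, ← scale_mul, ← mul_scale, lamRtilde_eq_iff.1 h, ← mul_assoc ζ⁻¹.lin,
      Chr.lin_inv_mul_lin, one_mul]
  refine Subtype.ext (WithConv.ext (LinearMap.ext fun x => ?_))
  change -((negPart ζ (degOp 𝓗 x)).coeff (-1)) = b.1 x
  rw [hζ.negPart_eq_inv]
  have e := congrArg (fun p : WithConv (H →ₗ[ℂ] Laurent) => (p x).coeff 0) hinv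
  have e1 : (scale lam (compDeg 𝓗 ζ⁻¹.lin) x).coeff 0 = (ζ⁻¹ (degOp 𝓗 x)).coeff (-1) :=
    coeff_lam_mul _ 0
  have e2 : ((-((InfChar.const b).1 * ζ⁻¹.lin) : WithConv (H →ₗ[ℂ] Laurent)) x).coeff 0 =
      -(b.1 x) := by
    have e3 : b.1 x = (b.1 * 1) x := by rw [mul_one]
    rw [e3, (ℛ ℂ x).convMul_apply, ofConv_neg, LinearMap.neg_apply, (ℛ ℂ x).convMul_apply]
    change coeffL 0 (-_) = _
    rw [map_neg, map_sum]
    congr 1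
    refine Finset.sum_congr rfl fun i _ => ?_
    rw [const_apply, ← Algebra.smul_def, map_smul, LinearMap.convOne_apply]
    exact congrArg _ (hζ.inv.coeff_zero _)
  simp only [e1, e2] at e
  rw [e, neg_neg]

/-- If `λR̃(ζ)` is constant, then `ζ⁻¹ ⋆ ζˢ` is holomorphic. -/
theorem isHolo_inv_mul_twist {ζ : Chr H} {b : InfChar H ℂ}
    (h : lamRtilde 𝓗 ζ = InfChar.const b) (s : ℂ) (x : H) :
    IsHolo ((ζ⁻¹ * twist 𝓗 ζ s) x) := by
  have hlin : ∀ s, (ζ⁻¹ * twist 𝓗 ζ s).lin = ζ⁻¹.lin * twistLin 𝓗 s ζ.lin := fun s => by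
    rw [Chr.lin_mul, lin_twist]
  have key : ∀ n, ∀ x ∈ 𝓗 n, ∀ s, (ζ⁻¹.lin * twistLin 𝓗 s ζ.lin) x ∈ holoPart := by
    intro n
    induction n using Nat.strong_induction_on with
    | _ n ih =>
      intro x hx s k hk
      -- The derivative of `ζ⁻¹ ⋆ ζˢ` is `(ζ⁻¹ ⋆ ζˢ) ⋆ bˢ`, where `bˢ` is holomorphic and zero in
      -- degree zero. By induction its negative coefficients vanish, so those of `ζ⁻¹ ⋆ ζˢ` keep
      -- their value at `s = 0`.
      have hder : ∀ s, HasDerivAt (fun s => ((ζ⁻¹.lin * twistLin 𝓗 s ζ.lin) x).coeff k) 0 s := by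
        intro s
        refine (hasDerivAt_coeff_convMul_twistLin 𝓗 ζ⁻¹.lin ζ.lin x s k).congr_deriv ?_
        rw [lamRtilde_eq_iff.1 h, twistLin_mul, ← mul_assoc]
        refine convMul_mem holoPart hx (fun i j hij a ha c hc => ?_) k hk
        rcases Nat.eq_zero_or_pos j with rfl | hj
        · rw [twistLin_of_mem 𝓗 s _ hc, apply_eq_zero_of_mem_zero
            (mem_infChar.1 (InfChar.const b).2).apply_one hc, mul_zero, mul_zero]
          exact zero_mem _
        · exact IsHolo.mul (ih i (by omega) a ha s)
            (twistLin_isHolo 𝓗 (fun y => isHolo_algebraMap (b.1 y)) s c)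
      have hconst := is_const_of_deriv_eq_zero (fun s => (hder s).differentiableAt)
        (fun s => (hder s).deriv) s 0
      refine hconst.trans ?_
      rw [twistLin_zero, Chr.lin_inv_mul_lin]
      exact isHolo_algebraMap _ k hk
  have h' := apply_mem_of_homogeneous (𝓗 := 𝓗) holoPart (fun n x hx => key n x hx s) x
  rwa [← hlin] at h'

/-- `ζˢ = (ζ⁻¹)⁻¹ ⋆ (ζ⁻¹ ⋆ ζˢ)` is a Birkhoff decomposition with negative part `ζ⁻¹` for every `s`.
-/
theorem isLocal_of_lamRtilde_eq_const {ζ : Chr H} {b : InfChar H ℂ}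
    (h : lamRtilde 𝓗 ζ = InfChar.const b) : IsLocal 𝓗 ζ := by
  have hB : ∀ s, IsBirkhoff (twist 𝓗 ζ s) ζ⁻¹ (ζ⁻¹ * twist 𝓗 ζ s) := fun s =>
    ⟨by group, (Chr.isPolar_of_lamRtilde_eq_const h).inv, isHolo_inv_mul_twist h s⟩
  intro s t
  rw [(hB s).negPart_eq, (hB t).negPart_eq]

/-- The scattering formula: the inverse of the negative part of a local character is recovered from
the `β`-function. -/
theorem IsLocal.lamRtilde_inv_negPart {φ : Chr H} (hφ : IsLocal 𝓗 φ) :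
    lamRtilde 𝓗 (negPart φ)⁻¹ = InfChar.const (betaFun 𝓗 φ) := by
  obtain ⟨gp, hgp⟩ := exists_isBirkhoff 𝓗 φ
  have hg : (negPart φ).IsPolar := hgp.polar
  set ζ := (negPart φ)⁻¹ with hζ
  have hζp : ζ.IsPolar := hg.inv
  -- By locality `φˢ = ζ ⋆ hs`, while twisting `φ = ζ ⋆ gp` gives `φˢ = ζˢ ⋆ gpˢ`; so `ζ⁻¹ ⋆ ζˢ = hs
  -- ⋆ (gpˢ)⁻¹`.
  have hholo : ∀ s x, IsHolo ((ζ⁻¹ * twist 𝓗 ζ s) x) := by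
    intro s
    obtain ⟨hs, hB⟩ := exists_isBirkhoff 𝓗 (twist 𝓗 φ s)
    have e1 : twist 𝓗 φ s = ζ * hs := by
      rw [hB.eq, hφ s 0, twist_zero]
    have e2 : twist 𝓗 φ s = twist 𝓗 ζ s * twist 𝓗 gp s := by
      rw [← twist_mul, ← hgp.eq]
    have e3 : ζ⁻¹ * twist 𝓗 ζ s = hs * (twist 𝓗 gp s)⁻¹ := by
      rw [eq_mul_inv_iff_mul_eq, mul_assoc, ← e2, e1, inv_mul_cancel_left]
    rw [e3]
    refine Chr.isHolo_mul hB.holo (Chr.isHolo_inv fun x => ?_)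
    have h := twistLin_isHolo 𝓗 (p := gp.lin) hgp.holo s x
    rwa [← lin_twist] at h
  have hval : (lamRtilde 𝓗 ζ).1 = ζ⁻¹.lin * scale lam (compDeg 𝓗 ζ.lin) := by
    rw [mul_scale]
    rfl
  -- `λR̃(ζ)` is the derivative at `s = 0` of this holomorphic family.
  have h1 : ∀ x, IsHolo ((lamRtilde 𝓗 ζ).1 x) := fun x k hk => by
    have hd := hasDerivAt_coeff_convMul_twistLin 𝓗 ζ⁻¹.lin ζ.lin x 0 k
    rw [twistLin_zero, ← hval] at hd
    refine hd.unique ((hasDerivAt_const (0 : ℂ) (0 : ℂ)).congr_of_eventuallyEq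
      (Filter.Eventually.of_forall fun s => ?_))
    have := hholo s x k hk
    change ((ζ⁻¹ * twist 𝓗 ζ s).lin x).coeff k = 0 at this
    rwa [Chr.lin_mul, lin_twist] at this
  -- `Y` maps into `ker ε`, so `R̃(ζ)` is polar and `λR̃(ζ)` has no positive powers of `λ`. With
  -- `h1`, only the constant coefficient remains.
  have h2 : ∀ x, (ζ⁻¹.lin * compDeg 𝓗 ζ.lin) x ∈ polarPart := fun x => by
    have hY : ∀ y, compDeg 𝓗 ζ.lin y ∈ polarPart := fun y => hζp _ (counit_degOp 𝓗 y)
    have e : ζ⁻¹.lin * compDeg 𝓗 ζ.lin =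
        (ζ⁻¹.lin - 1) * compDeg 𝓗 ζ.lin + compDeg 𝓗 ζ.lin := by noncomm_ring
    rw [e]
    exact add_mem (convMul_mem_of_forall polarPart
      (fun a c => IsPolar.mul (hζp.inv.sub_one a) (hY c)) x) (hY x)
  have h3 : lamRtilde 𝓗 ζ = InfChar.const (InfChar.evalZero (lamRtilde 𝓗 ζ)) := by
    refine Subtype.ext (WithConv.ext (LinearMap.ext fun x => Laurent.ext fun k => ?_))
    change ((lamRtilde 𝓗 ζ).1 x).coeff k =
      (algebraMap ℂ Laurent (((lamRtilde 𝓗 ζ).1 x).coeff 0)).coeff k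
    rw [Laurent.coeff_algebraMap]
    split_ifs with hk
    · rw [hk]
    · rcases lt_or_gt_of_ne hk with hk | hk
      · exact h1 x k hk
      · refine (coeff_lam_mul _ k).trans (h2 x _ (by omega))
  have h4 := betaFun_eq_of_lamRtilde_eq_const h3
  -- The `β`-function depends only on the negative part, and `ζ₋ = ζ⁻¹ = φ₋`.
  have h5 : betaFun 𝓗 φ = betaFun 𝓗 ζ := by
    have e : negPart ζ = negPart φ := by rw [hζp.negPart_eq_inv, hζ, inv_inv]
    refine Subtype.ext (WithConv.ext (LinearMap.ext fun x => ?_))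
    change -((negPart φ (degOp 𝓗 x)).coeff (-1)) = -((negPart ζ (degOp 𝓗 x)).coeff (-1))
    rw [e]
  rw [h5, h4]
  exact h3

end Scattering

/-! ### Polynomial families of Laurent series -/

section Families

open Polynomial

/-- Evaluation of a polynomial family of Laurent series at `c`. -/
def evalFam (c : ℂ) : Laurent[X] →ₐ[ℂ] Laurent :=
  (Polynomial.aeval (algebraMap ℂ Laurent c)).restrictScalars ℂ

theorem evalFam_monomial (c : ℂ) (k : ℕ) (a : Laurent) :
    evalFam c (monomial k a) = c ^ k • a := by
  change Polynomial.aeval (algebraMap ℂ Laurent c) (monomial k a) = _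
  rw [aeval_monomial, ← map_pow, Algebra.algebraMap_self, RingHom.id_apply, mul_comm,
    ← Algebra.smul_def]

theorem hasDerivAt_evalFam (q : Laurent[X]) (c : ℂ) (n : ℤ) :
    HasDerivAt (fun c => (evalFam c q).coeff n) ((evalFam c (derivative q)).coeff n) c := by
  induction q using Polynomial.induction_on' with
  | add p q hp hq =>
    simp only [map_add, Laurent.coeff_add]
    exact hp.add hq
  | monomial k a =>
    simp only [derivative_monomial, evalFam_monomial, Laurent.coeff_smul]
    refine ((hasDerivAt_pow k c).mul_const (a.coeff n)).congr_deriv ?_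
    have e : a * (k : Laurent) = (k : ℂ) • a := by
      rw [Algebra.smul_def, map_natCast, mul_comm]
    rw [e, Laurent.coeff_smul]
    ring

theorem hasDerivAt_evalFam_ofReal (q : Laurent[X]) (t : ℝ) (n : ℤ) :
    HasDerivAt (fun t : ℝ => (evalFam (t : ℂ) q).coeff n)
      ((evalFam (t : ℂ) (derivative q)).coeff n) t :=
  (hasDerivAt_evalFam q t n).comp_ofReal

/-- The polynomial families with coefficients in a subspace. -/
def famSubmodule (S : Submodule ℂ Laurent) : Submodule ℂ Laurent[X] where
  carrier := {q | ∀ k, q.coeff k ∈ S}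
  add_mem' ha hb k := by rw [Polynomial.coeff_add]; exact add_mem (ha k) (hb k)
  zero_mem' k := by rw [Polynomial.coeff_zero]; exact zero_mem S
  smul_mem' c q hq k := by rw [Polynomial.coeff_smul]; exact S.smul_mem c (hq k)

theorem evalFam_mem {S : Submodule ℂ Laurent} {q : Laurent[X]} (hq : q ∈ famSubmodule S) (c : ℂ) :
    evalFam c q ∈ S := by
  rw [← Polynomial.sum_monomial_eq q, Polynomial.sum_def, map_sum]
  refine sum_mem fun k _ => ?_
  rw [evalFam_monomial]
  exact S.smul_mem _ (hq k)

theorem derivative_mem_famSubmodule {S : Submodule ℂ Laurent} {q : Laurent[X]}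
    (hq : q ∈ famSubmodule S) : derivative q ∈ famSubmodule S := fun k => by
  have e : q.coeff (k + 1) * ((k : Laurent) + 1) = ((k : ℂ) + 1) • q.coeff (k + 1) := by
    rw [Algebra.smul_def, map_add, map_natCast, map_one, mul_comm]
  rw [Polynomial.coeff_derivative, e]
  exact S.smul_mem _ (hq (k + 1))

theorem mul_mem_famSubmodule {S : Submodule ℂ Laurent} (hS : ∀ a ∈ S, ∀ b ∈ S, a * b ∈ S)
    {p q : Laurent[X]} (hp : p ∈ famSubmodule S) (hq : q ∈ famSubmodule S) :
    p * q ∈ famSubmodule S := fun k => by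
  rw [Polynomial.coeff_mul]
  exact sum_mem fun i _ => hS _ (hp _) _ (hq _)

/-- The pole part of a polynomial family. -/
def famPminus : Laurent[X] →ₗ[ℂ] Laurent[X] :=
  Polynomial.lsum (fun k => (monomial k).restrictScalars ℂ ∘ₗ Pminus)

theorem coeff_famPminus (q : Laurent[X]) (k : ℕ) : (famPminus q).coeff k = Pminus (q.coeff k) := by
  rw [famPminus, Polynomial.lsum_apply, Polynomial.sum_def, Polynomial.finsetSum_coeff]
  simp only [LinearMap.comp_apply, LinearMap.restrictScalars_apply, coeff_monomial]
  rw [Finset.sum_ite_eq' q.support k]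
  split_ifs with h
  · rfl
  · rw [Polynomial.notMem_support_iff.1 h, map_zero]

/-- Lets `exists_birkhoff` factorize a whole family at once, with factors polynomial in `t` and
hence differentiable. -/
theorem isSplitting_famPminus :
    IsSplitting famPminus (famSubmodule polarPart) (famSubmodule holoPart) where
  mem_left q k := by rw [coeff_famPminus]; exact isPolar_Pminus _
  mem_right q k := by
    rw [Polynomial.coeff_sub, coeff_famPminus]
    exact isHolo_Pplus (q.coeff k)
  disjoint q hq hq' := Polynomial.ext fun k => by
    rw [Polynomial.coeff_zero]
    exact IsPolar.eq_zero_of_isHolo (hq k) (hq' k)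
  mul_left _ ha _ hb := mul_mem_famSubmodule (fun _ ha _ hb => IsPolar.mul ha hb) ha hb
  mul_right _ ha _ hb := mul_mem_famSubmodule (fun _ ha _ hb => IsHolo.mul ha hb) ha hb
  one_mem k := by
    rw [Polynomial.coeff_one]
    split_ifs
    · exact isHolo_one
    · exact zero_mem _

end Families

/-! ### Convolution algebra over `𝒜[t]`. -/

section ConvFamilies

open Polynomial

variable {H : Type*} [CommRing H] [HopfAlgebra ℂ H]

/-- Postcomposition with an algebra morphism, a ring morphism of convolution algebras. -/
def postHom {B B' : Type*} [CommRing B] [Algebra ℂ B] [CommRing B'] [Algebra ℂ B']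
    (T : B →ₐ[ℂ] B') : WithConv (H →ₗ[ℂ] B) →+* WithConv (H →ₗ[ℂ] B') where
  toFun p := toConv (T.toLinearMap ∘ₗ p.ofConv)
  map_one' := by
    ext x
    exact T.commutes _
  map_mul' p q := WithConv.ext (LinearMap.algHom_comp_convMul_distrib T p q)
  map_zero' := by
    ext x
    exact map_zero T
  map_add' p q := by
    ext x
    exact map_add T _ _

theorem postHom_apply {B B' : Type*} [CommRing B] [Algebra ℂ B] [CommRing B'] [Algebra ℂ B']
    (T : B →ₐ[ℂ] B') (p : WithConv (H →ₗ[ℂ] B)) (x : H) : postHom T p x = T (p x) := rfl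

/-- The derivative of a polynomial family of linear maps. -/
def convDeriv (p : WithConv (H →ₗ[ℂ] Laurent[X])) : WithConv (H →ₗ[ℂ] Laurent[X]) :=
  toConv ((derivative.restrictScalars ℂ) ∘ₗ p.ofConv)

theorem convDeriv_apply (p : WithConv (H →ₗ[ℂ] Laurent[X])) (x : H) :
    convDeriv p x = derivative (p x) := rfl

theorem convDeriv_mul (p q : WithConv (H →ₗ[ℂ] Laurent[X])) :
    convDeriv (p * q) = convDeriv p * q + p * convDeriv q := by
  ext1
  refine LinearMap.ext fun x => ?_
  rw [convDeriv_apply, ofConv_add, LinearMap.add_apply, (ℛ ℂ x).convMul_apply,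
    (ℛ ℂ x).convMul_apply, (ℛ ℂ x).convMul_apply, derivative_sum, ← Finset.sum_add_distrib]
  exact Finset.sum_congr rfl fun i _ => by
    rw [derivative_mul, convDeriv_apply, convDeriv_apply]

/-- A constant polynomial family. -/
def constFam : WithConv (H →ₗ[ℂ] Laurent) →+* WithConv (H →ₗ[ℂ] Laurent[X]) :=
  postHom Polynomial.CAlgHom

theorem constFam_apply (p : WithConv (H →ₗ[ℂ] Laurent)) (x : H) :
    constFam p x = Polynomial.C (p x) := rfl

theorem convDeriv_constFam (p : WithConv (H →ₗ[ℂ] Laurent)) : convDeriv (constFam p) = 0 := by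
  ext1
  refine LinearMap.ext fun x => ?_
  rw [convDeriv_apply, constFam_apply, derivative_C]
  rfl

theorem postHom_evalFam_constFam (c : ℂ) (p : WithConv (H →ₗ[ℂ] Laurent)) :
    postHom (evalFam c) (constFam p) = p := by
  ext1
  refine LinearMap.ext fun x => ?_
  rw [postHom_apply, constFam_apply, ← monomial_zero_left, evalFam_monomial, pow_zero, one_smul]

/-- The value at `c` of a family of characters. -/
def evalChr (c : ℂ) (g : H →ₐ[ℂ] Laurent[X]) : Chr H := toConv ((evalFam c).comp g)

theorem lin_evalChr (c : ℂ) (g : H →ₐ[ℂ] Laurent[X]) :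
    (evalChr c g).lin = postHom (evalFam c) (toConv g.toLinearMap) := rfl

end ConvFamilies

/-! ### Exponentials -/

section Exponential

open Polynomial

variable {H : Type*} [CommRing H] [HopfAlgebra ℂ H] (𝓗 : ℕ → Submodule ℂ H) [GradedAlgebra 𝓗]
  [IsConnectedGraded 𝓗]

theorem vanishesBelow_pow {B : Type*} [CommRing B] [Algebra ℂ B] {Z : WithConv (H →ₗ[ℂ] B)}
    (hZ : Z 1 = 0) (k : ℕ) : VanishesBelow 𝓗 k (Z ^ k) := by
  induction k with
  | zero => exact vanishesBelow_zero _
  | succ k ih => rw [pow_succ]; exact ih.mul_succ hZ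

/-- The terms of the exponential series `exp(tZ)`, as polynomial families in `t`. -/
def expTerm (Z : WithConv (H →ₗ[ℂ] Laurent)) (k : ℕ) : WithConv (H →ₗ[ℂ] Laurent[X]) :=
  toConv ((monomial k).restrictScalars ℂ ∘ₗ (((k.factorial : ℂ)⁻¹) • Z ^ k).ofConv)

theorem expTerm_apply (Z : WithConv (H →ₗ[ℂ] Laurent)) (k : ℕ) (x : H) :
    expTerm Z k x = monomial k (((k.factorial : ℂ)⁻¹) • (Z ^ k) x) := rfl

theorem monomial_mul_apply (k : ℕ) (c : ℂ) (p q : WithConv (H →ₗ[ℂ] Laurent)) (x : H) :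
    (toConv ((monomial k).restrictScalars ℂ ∘ₗ (c • p).ofConv) * constFam q) x =
      monomial k (c • (p * q) x) := by
  rw [(ℛ ℂ x).convMul_apply, (ℛ ℂ x).convMul_apply, Finset.smul_sum, map_sum]
  refine Finset.sum_congr rfl fun i _ => ?_
  change monomial k (c • p _) * Polynomial.C (q _) = _
  rw [monomial_mul_C, smul_mul_assoc]

theorem convDeriv_expTerm_succ (Z : WithConv (H →ₗ[ℂ] Laurent)) (k : ℕ) :
    convDeriv (expTerm Z (k + 1)) = expTerm Z k * constFam Z := by
  ext1
  refine LinearMap.ext fun x => ?_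
  rw [convDeriv_apply, expTerm_apply, derivative_monomial, Nat.add_sub_cancel]
  refine Eq.trans ?_ (monomial_mul_apply k _ _ _ x).symm
  congr 1
  rw [pow_succ, mul_comm, ← nsmul_eq_mul, ← Nat.cast_smul_eq_nsmul ℂ, smul_smul,
    Nat.factorial_succ]
  congr 1
  have h1 : ((k : ℂ) + 1) ≠ 0 := Nat.cast_add_one_ne_zero k
  push_cast
  field_simp

theorem convDeriv_expTerm_zero (Z : WithConv (H →ₗ[ℂ] Laurent)) :
    convDeriv (expTerm Z 0) = 0 := by
  ext1
  refine LinearMap.ext fun x => ?_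
  rw [convDeriv_apply, expTerm_apply, derivative_monomial, Nat.cast_zero, mul_zero, map_zero]
  rfl

/-- The one-parameter group `t ↦ exp(tZ)` is a polynomial family of characters. -/
theorem exists_expFam (Z : InfChar H Laurent) :
    ∃ E : H →ₐ[ℂ] Laurent[X],
      (∀ N, VanishesBelow 𝓗 N
        (toConv E.toLinearMap - ∑ k ∈ Finset.range N, expTerm Z.1 k)) ∧
      convDeriv (toConv E.toLinearMap) = toConv E.toLinearMap * constFam Z.1 ∧
      evalChr 0 E = 1 := by
  have hZt := mem_infChar.1 Z.2
  have hCt : IsTangent 1 (constFam (H := H) Z.1) := fun x y => by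
    rw [constFam_apply, hZt x y]
    simp only [map_add, map_mul]
    rfl
  have hu : ∀ k, VanishesBelow 𝓗 k (expTerm Z.1 k) := fun k i hi x hx => by
    rw [expTerm_apply, vanishesBelow_pow 𝓗 hZt.apply_one k i hi x hx, smul_zero, map_zero]
  obtain ⟨g, hg⟩ := exists_locally_finite_sum 𝓗 _ hu
  have hgx : ∀ N, ∀ i < N, ∀ x ∈ 𝓗 i, g x = (∑ k ∈ Finset.range N, expTerm Z.1 k).ofConv x :=
    fun N i hi x hx => sub_eq_zero.1 (hg N i hi x hx)
  have hder : convDeriv g = g * constFam Z.1 := by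
    refine eq_of_vanishesBelow_sub (𝓗 := 𝓗) fun N => ?_
    have h1 := (hg N).mul_right (constFam Z.1)
    intro i hi x hx
    have h2 := h1 i hi x hx
    -- Differentiation shifts the index, so `N + 1` terms are taken to obtain the first `N` terms of
    -- `g ⋆ Z`.
    have h3 : derivative (g x) =
        ((∑ k ∈ Finset.range N, expTerm Z.1 k) * constFam Z.1).ofConv x := by
      rw [hgx (N + 1) i (by omega) x hx, Finset.sum_mul, ofConv_sum, ofConv_sum,
        LinearMap.sum_apply, LinearMap.sum_apply, derivative_sum, Finset.sum_range_succ']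
      have h0 : derivative (expTerm Z.1 0 x) = 0 :=
        congrArg (fun p : WithConv (H →ₗ[ℂ] Laurent[X]) => p x) (convDeriv_expTerm_zero Z.1)
      rw [h0, add_zero]
      exact Finset.sum_congr rfl fun k _ =>
        congrArg (fun p : WithConv (H →ₗ[ℂ] Laurent[X]) => p x) (convDeriv_expTerm_succ Z.1 k)
    rw [sub_mul] at h2
    change derivative (g x) - (g * constFam Z.1) x = 0
    rw [h3]
    have h4 : (g * constFam Z.1) x -
      ((∑ k ∈ Finset.range N, expTerm Z.1 k) * constFam Z.1).ofConv x = 0 := h2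
    rw [← neg_sub, h4, neg_zero]
  have hg1 : g 1 = 1 := by
    rw [hgx 1 0 one_pos 1 SetLike.GradedOne.one_mem, Finset.sum_range_one, expTerm_apply, pow_zero,
      LinearMap.convOne_apply]
    simp
  have hev : ∀ x, evalFam 0 (g x) = algebraMap ℂ Laurent (counit (R := ℂ) x) := by
    have h : postHom (evalFam 0) g = 1 := by
      refine withConv_ext_of_homogeneous (𝓗 := 𝓗) fun n x hx => ?_
      rw [postHom_apply, hgx (n + 1) n n.lt_succ_self x hx, ofConv_sum, LinearMap.sum_apply,
        map_sum, Finset.sum_range_succ', Finset.sum_eq_zero, zero_add, expTerm_apply,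
        evalFam_monomial]
      · simp
      · intro k _
        rw [expTerm_apply, evalFam_monomial, zero_pow k.succ_ne_zero, zero_smul]
    intro x
    exact congrArg (fun p : WithConv (H →ₗ[ℂ] Laurent) => p x) h
  -- By the Leibniz rule the defect has zero derivative in `t`, and it vanishes at `t = 0`.
  have hgm : IsMult g := isMult_of_induction (𝓗 := 𝓗) fun m n ih x hx y hy => by
    have h := convMul_tangent_leibniz hx hy hCt ih
    rw [← hder, convDeriv_apply, convDeriv_apply, convDeriv_apply] at h
    have hd : derivative (multDefect g x y) = 0 := by
      rw [multDefect, derivative_sub, derivative_mul, h, sub_self]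
    have h0 : evalFam 0 (multDefect g x y) = 0 := by
      rw [multDefect, map_sub, map_mul (evalFam 0), hev, hev, hev, Bialgebra.counit_mul,
        map_mul (algebraMap ℂ Laurent), sub_self]
    obtain ⟨a, ha⟩ : ∃ a, multDefect g x y = Polynomial.C a := by
      refine ⟨(multDefect g x y).coeff 0, Polynomial.ext fun k => ?_⟩
      rcases k with _ | k
      · rw [Polynomial.coeff_C_zero]
      · rw [Polynomial.coeff_C_succ]
        have e := congrArg (fun p => Polynomial.coeff p k) hd
        have e' : (multDefect g x y).coeff (k + 1) * ((k : Laurent) + 1) =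
            ((k : ℂ) + 1) • (multDefect g x y).coeff (k + 1) := by
          rw [Algebra.smul_def, map_add, map_natCast, map_one, mul_comm]
        simp only [Polynomial.coeff_derivative, Polynomial.coeff_zero, e'] at e
        exact (smul_eq_zero.1 e).resolve_left (Nat.cast_add_one_ne_zero k)
    rw [ha, ← monomial_zero_left, evalFam_monomial, pow_zero, one_smul] at h0
    rw [ha, h0, map_zero]
  refine ⟨AlgHom.ofLinearMap g.ofConv hg1 hgm, hg, hder, ?_⟩
  apply Chr.lin_injective
  refine WithConv.ext (LinearMap.ext fun x => ?_)
  exact hev x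

omit [IsConnectedGraded 𝓗] in
variable {𝓗} in
theorem isExp_evalChr {Z : InfChar H Laurent} {E : H →ₐ[ℂ] Laurent[X]}
    (hE : ∀ N, VanishesBelow 𝓗 N
      (toConv E.toLinearMap - ∑ k ∈ Finset.range N, expTerm Z.1 k)) (c : ℂ) :
    IsExp (c • Z) (evalChr c E) := by
  have hterm : ∀ k x, evalFam c (expTerm Z.1 k x) =
      ((k.factorial : ℂ)⁻¹) • ((c • Z).1 ^ k) x := fun k x => by
    have e : (c • Z).1 = c • Z.1 := rfl
    rw [expTerm_apply, evalFam_monomial, e, _root_.smul_pow, ofConv_smul, LinearMap.smul_apply, smul_comm]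
  intro x
  induction x using DirectSum.Decomposition.inductionOn 𝓗 with
  | zero => exact Filter.Eventually.of_forall fun N => by simp
  | add x y hx hy =>
    filter_upwards [hx, hy] with N hx hy
    simp only [map_add, smul_add, Finset.sum_add_distrib, hx, hy]
  | @homogeneous n x =>
    filter_upwards [Filter.eventually_gt_atTop n] with N hN
    have h : (toConv E.toLinearMap).ofConv (x : H) =
        (∑ k ∈ Finset.range N, expTerm Z.1 k).ofConv x := sub_eq_zero.1 (hE N n hN x x.2)
    change evalFam c ((toConv E.toLinearMap).ofConv (x : H)) = _
    rw [h, ofConv_sum, LinearMap.sum_apply, map_sum]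
    exact Finset.sum_congr rfl fun k _ => hterm k x

variable {𝓗} in
/-- The exponential of `cZ` commutes with everything that commutes with `Z`. -/
theorem commute_evalChr {Z : InfChar H Laurent} {E : H →ₐ[ℂ] Laurent[X]}
    (hE : ∀ N, VanishesBelow 𝓗 N
      (toConv E.toLinearMap - ∑ k ∈ Finset.range N, expTerm Z.1 k)) (c : ℂ)
    {W : WithConv (H →ₗ[ℂ] Laurent)} (hW : Commute Z.1 W) : Commute (evalChr c E).lin W := by
  refine eq_of_vanishesBelow_sub (𝓗 := 𝓗) fun N => ?_
  set S := ∑ k ∈ Finset.range N, postHom (evalFam c) (expTerm Z.1 k) with hS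
  have hterm : ∀ k, postHom (evalFam c) (expTerm Z.1 k) =
      (c ^ k * (k.factorial : ℂ)⁻¹) • Z.1 ^ k := fun k => by
    ext1
    refine LinearMap.ext fun x => ?_
    rw [postHom_apply, expTerm_apply, evalFam_monomial, smul_smul]
    rfl
  have hSW : Commute S W := Commute.sum_left _ _ _ fun k _ => by
    rw [hterm]
    exact (hW.pow_left k).smul_left _
  have hr : VanishesBelow 𝓗 N ((evalChr c E).lin - S) := fun i hi x hx => by
    rw [hS, ← map_sum, lin_evalChr, ← map_sub, postHom_apply, hE N i hi x hx, map_zero]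
  -- `W` commutes with the partial sums, so only the tail contributes to the commutator.
  have e : (evalChr c E).lin * W - W * (evalChr c E).lin =
      ((evalChr c E).lin - S) * W - W * ((evalChr c E).lin - S) := by
    rw [sub_mul, mul_sub, hSW.eq]
    abel
  rw [e]
  exact (hr.mul_right W).sub (hr.mul_left W)

end Exponential

/-! ### The Lax pair equation -/

section LaxFlow

open Polynomial

variable {H : Type*} [CommRing H] [HopfAlgebra ℂ H]

theorem Ad_val (g : Chr H) (Z : InfChar H Laurent) : (Ad g Z).1 = g.lin * Z.1 * g⁻¹.lin := rfl

theorem Ad_one (Z : InfChar H Laurent) : Ad 1 Z = Z :=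
  Subtype.ext (by rw [Ad_val, inv_one, Chr.lin_one, one_mul, mul_one])

theorem Ad_eq_self_iff {g : Chr H} {Z : InfChar H Laurent} : Ad g Z = Z ↔ Commute g.lin Z.1 := by
  rw [← Subtype.coe_inj, Ad_val]
  constructor
  · intro h
    have h' := congrArg (· * g.lin) h
    simp only [mul_assoc, Chr.lin_inv_mul_lin, mul_one] at h'
    exact h'
  · intro h
    rw [h.eq, mul_assoc, Chr.lin_mul_lin_inv, mul_one]

theorem Ad_mul (g k : Chr H) (Z : InfChar H Laurent) : Ad (g * k) Z = Ad g (Ad k Z) :=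
  Subtype.ext (by
    rw [Ad_val, Ad_val, Ad_val, mul_inv_rev, Chr.lin_mul, Chr.lin_mul]
    noncomm_ring)

theorem lie_val (Z W : InfChar H Laurent) : (⁅Z, W⁆).1 = Z.1 * W.1 - W.1 * Z.1 := rfl

theorem lie_eq_zero_iff {Z W : InfChar H Laurent} : ⁅Z, W⁆ = 0 ↔ Commute Z.1 W.1 := by
  rw [← Subtype.coe_inj, lie_val]
  exact sub_eq_zero

theorem hasDerivAt_postHom_evalFam (p : WithConv (H →ₗ[ℂ] Laurent[X])) (x : H) (c : ℂ) (n : ℤ) :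
    HasDerivAt (fun c => (postHom (evalFam c) p x).coeff n)
      ((postHom (evalFam c) (convDeriv p) x).coeff n) c :=
  hasDerivAt_evalFam (p x) c n

/-- The value at `Z` of an `Ad`-covariant map commutes with `Z`. -/
theorem AdCovariant.commute (𝓗 : ℕ → Submodule ℂ H) [GradedAlgebra 𝓗] [IsConnectedGraded 𝓗]
    {f : InfChar H Laurent → InfChar H Laurent} (hf : AdCovariant f) (Z : InfChar H Laurent) :
    Commute Z.1 (f Z).1 := by
  obtain ⟨E, hE, hder, h0⟩ := exists_expFam 𝓗 Z
  set El : WithConv (H →ₗ[ℂ] Laurent[X]) := toConv E.toLinearMap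
  -- `exp(cZ)` commutes with `Z`, so its adjoint action fixes `Z` and, by covariance, `f Z`.
  have hcomm : ∀ c, Commute (evalChr c E).lin (f Z).1 := fun c => by
    rw [← Ad_eq_self_iff, hf, Ad_eq_self_iff.2 (commute_evalChr hE c (Commute.refl Z.1))]
  have h0' : postHom (evalFam 0) El = 1 := by rw [← lin_evalChr, h0, Chr.lin_one]
  have hl : postHom (evalFam 0) (convDeriv (El * constFam (f Z).1)) = Z.1 * (f Z).1 := by
    rw [convDeriv_mul, convDeriv_constFam, mul_zero, add_zero, hder, map_mul, map_mul,
      postHom_evalFam_constFam, postHom_evalFam_constFam, h0', one_mul]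
  have hr : postHom (evalFam 0) (convDeriv (constFam (f Z).1 * El)) = (f Z).1 * Z.1 := by
    rw [convDeriv_mul, convDeriv_constFam, zero_mul, zero_add, hder, map_mul, map_mul,
      postHom_evalFam_constFam, postHom_evalFam_constFam, h0', one_mul]
  have heq : ∀ c, postHom (evalFam c) (El * constFam (f Z).1) =
      postHom (evalFam c) (constFam (f Z).1 * El) := fun c => by
    rw [map_mul, map_mul, postHom_evalFam_constFam, ← lin_evalChr, (hcomm c).eq]
  refine WithConv.ext (LinearMap.ext fun x => Laurent.ext fun n => ?_)
  rw [← hl, ← hr]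
  -- The two products `exp(cZ) ⋆ f(Z)` and `f(Z) ⋆ exp(cZ)` agree for all `c`, so their derivatives
  -- at `c = 0` agree.
  refine (hasDerivAt_postHom_evalFam _ x 0 n).unique ?_
  simp only [heq]
  exact hasDerivAt_postHom_evalFam _ x 0 n

/-- Postcomposition of values with `P₊`. -/
theorem map_Pplus_apply (Z : InfChar H Laurent) (x : H) :
    (InfChar.map Pplus Z).1 x = Pplus (Z.1 x) := rfl

theorem laxM_eq (f : InfChar H Laurent → InfChar H Laurent) (Z : InfChar H Laurent) :
    laxM f Z = InfChar.map Pplus (f Z) - (1 / 2 : ℂ) • f Z := by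
  refine Subtype.ext (WithConv.ext (LinearMap.ext fun x => ?_))
  change (1 / 2 : ℂ) • ((Pplus - Pminus) ((f Z).1 x)) =
    Pplus ((f Z).1 x) - (1 / 2 : ℂ) • (f Z).1 x
  have e : Pminus ((f Z).1 x) = (f Z).1 x - Pplus ((f Z).1 x) := by simp [Pplus]
  rw [LinearMap.sub_apply, e]
  module

/-- `½R = P₊ - ½`, and the term `½ f(Z)` commutes with `Z`. -/
theorem AdCovariant.lie_laxM (𝓗 : ℕ → Submodule ℂ H) [GradedAlgebra 𝓗] [IsConnectedGraded 𝓗]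
    {f : InfChar H Laurent → InfChar H Laurent} (hf : AdCovariant f) (Z : InfChar H Laurent) :
    ⁅Z, laxM f Z⁆ = ⁅Z, InfChar.map Pplus (f Z)⁆ := by
  rw [laxM_eq, lie_sub, lie_smul, lie_eq_zero_iff.2 (hf.commute 𝓗 Z), smul_zero, sub_zero]

/-- Solutions of the Lax pair equation with holomorphic initial value stay holomorphic. -/
theorem IsLaxSolution.isHolo (𝓗 : ℕ → Submodule ℂ H) [GradedAlgebra 𝓗] [IsConnectedGraded 𝓗]
    {f : InfChar H Laurent → InfChar H Laurent} (hf : AdCovariant f) {L₀ : InfChar H Laurent}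
    (h₀ : ∀ x, IsHolo (L₀.1 x)) {L : ℝ → InfChar H Laurent} (hL : IsLaxSolution f L₀ L)
    (t : ℝ) (x : H) : IsHolo ((L t).1 x) := by
  have key : ∀ n, ∀ x ∈ 𝓗 n, ∀ t, (L t).1 x ∈ holoPart := by
    intro n
    induction n using Nat.strong_induction_on with
    | _ n ih =>
      intro x hx t k hk
      -- `P₊ f(L)` is holomorphic and vanishes in degree zero, so the commutator in degree `n` uses
      -- `L` only in lower degrees, where it is holomorphic by induction.
      have hder : ∀ t, HasDerivAt (fun s : ℝ => ((L s).1 x).coeff k) 0 t := by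
        intro t
        refine (hL.lax t x k).congr_deriv ?_
        rw [hf.lie_laxM 𝓗, lie_val]
        have hLt := (mem_infChar.1 (L t).2).apply_one
        have hPt := (mem_infChar.1 (InfChar.map Pplus (f (L t))).2).apply_one
        have hP : ∀ y, (InfChar.map Pplus (f (L t))).1 y ∈ holoPart := fun y => isHolo_Pplus _
        refine holoPart.sub_mem (convMul_mem holoPart hx fun i j hij a ha b hb => ?_)
          (convMul_mem holoPart hx fun i j hij a ha b hb => ?_) k hk
        · rcases Nat.eq_zero_or_pos j with rfl | hj
          · rw [apply_eq_zero_of_mem_zero hPt hb, mul_zero]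
            exact zero_mem _
          · exact IsHolo.mul (ih i (by omega) a ha t) (hP b)
        · rcases Nat.eq_zero_or_pos i with rfl | hi
          · rw [apply_eq_zero_of_mem_zero hPt ha, zero_mul]
            exact zero_mem _
          · exact IsHolo.mul (hP a) (ih j (by omega) b hb t)
      refine (is_const_of_deriv_eq_zero (fun s => (hder s).differentiableAt)
        (fun s => (hder s).deriv) t 0).trans ?_
      rw [hL.init]
      exact h₀ x k hk
  exact apply_mem_of_homogeneous (𝓗 := 𝓗) holoPart (fun n x hx => key n x hx t) x

/-- The inverse of a family of characters. -/
def invFam (g : H →ₐ[ℂ] Laurent[X]) : H →ₐ[ℂ] Laurent[X] :=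
  g.comp (HopfAlgebra.antipodeAlgHom ℂ H)

theorem lin_evalChr_inv (c : ℂ) (g : H →ₐ[ℂ] Laurent[X]) :
    (evalChr c g)⁻¹.lin = postHom (evalFam c) (toConv (invFam g).toLinearMap) := rfl

theorem invFam_mul_self (g : H →ₐ[ℂ] Laurent[X]) :
    toConv (invFam g).toLinearMap * toConv g.toLinearMap = 1 := by
  refine WithConv.ext (LinearMap.ext fun x => ?_)
  rw [(ℛ ℂ x).convMul_apply]
  have h := congrArg g (HopfAlgebra.sum_antipode_mul_eq_algebraMap_counit (ℛ ℂ x))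
  rw [map_sum, AlgHom.commutes] at h
  rw [LinearMap.convOne_apply, ← h]
  exact Finset.sum_congr rfl fun i _ => (map_mul g _ _).symm

/-- The derivative of the family `t ↦ Ad(g(t)) Z`. -/
theorem hasDerivAt_Ad_evalChr (g : H →ₐ[ℂ] Laurent[X]) (Z : InfChar H Laurent) (t : ℝ) (x : H)
    (n : ℤ) :
    HasDerivAt (fun s : ℝ => ((Ad (evalChr s g) Z).1 x).coeff n)
      (((postHom (evalFam t) (convDeriv (toConv g.toLinearMap)) * (evalChr t g)⁻¹.lin *
          (Ad (evalChr t g) Z).1 -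
        (Ad (evalChr t g) Z).1 * (postHom (evalFam t) (convDeriv (toConv g.toLinearMap)) *
          (evalChr t g)⁻¹.lin)) x).coeff n) t := by
  set G : WithConv (H →ₗ[ℂ] Laurent[X]) := toConv g.toLinearMap with hG
  set A := G * constFam Z.1 * toConv (invFam g).toLinearMap with hA
  have hval : ∀ c : ℂ, (Ad (evalChr c g) Z).1 = postHom (evalFam c) A := fun c => by
    rw [Ad_val, lin_evalChr_inv, lin_evalChr, hA, map_mul, map_mul, postHom_evalFam_constFam]
  -- Differentiating `A ⋆ G = G ⋆ Z` instead of `A` avoids the derivative of the inverse family.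
  have hAG : A * G = G * constFam Z.1 := by
    rw [hA, mul_assoc, hG, invFam_mul_self, mul_one]
  have hd : convDeriv A * G + A * convDeriv G = convDeriv G * constFam Z.1 := by
    rw [← convDeriv_mul, hAG, convDeriv_mul, convDeriv_constFam, mul_zero, add_zero]
  have hd' := congrArg (postHom (evalFam (t : ℂ))) hd
  rw [map_add, map_mul _ (convDeriv A), map_mul _ A, map_mul _ (convDeriv G),
    postHom_evalFam_constFam, ← hval,
    ← lin_evalChr (t : ℂ) g] at hd'
  have hgi := Chr.lin_mul_lin_inv (evalChr (t : ℂ) g)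
  have hig := Chr.lin_inv_mul_lin (evalChr (t : ℂ) g)
  have hAd := Ad_val (evalChr (t : ℂ) g) Z
  set b := (evalChr (t : ℂ) g).lin
  set bi := (evalChr (t : ℂ) g)⁻¹.lin
  set l := (Ad (evalChr (t : ℂ) g) Z).1
  set b' := postHom (evalFam (t : ℂ)) (convDeriv G)
  have hl : Z.1 * bi = bi * l := by
    rw [hAd, ← mul_assoc, ← mul_assoc, hig, one_mul]
  have e : postHom (evalFam (t : ℂ)) (convDeriv A) = b' * bi * l - l * (b' * bi) := by
    have h1 := congrArg (· * bi) hd'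
    simp only [add_mul, mul_assoc, hgi, mul_one, hl] at h1
    rw [mul_assoc]
    exact eq_sub_of_add_eq h1
  rw [← e]
  simp only [hval]
  exact hasDerivAt_evalFam_ofReal (A x) t n

/-- The Lax pair equation of an `Ad`-covariant map is solved by Birkhoff factorization. -/
theorem AdCovariant.exists_laxSolution (𝓗 : ℕ → Submodule ℂ H) [GradedAlgebra 𝓗]
    [IsConnectedGraded 𝓗] {f : InfChar H Laurent → InfChar H Laurent} (hf : AdCovariant f)
    (L₀ : InfChar H Laurent) :
    ∃ L : ℝ → InfChar H Laurent, IsLaxSolution f L₀ L ∧ IsFactorizationFlow f L₀ L := by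
  obtain ⟨E, hE, hEder, hE0⟩ := exists_expFam 𝓗 (-f L₀)
  obtain ⟨gm, hpolar, hholo⟩ := exists_birkhoff 𝓗 isSplitting_famPminus E
  let gp : H →ₐ[ℂ] Laurent[X] := (toConv gm * toConv E : WithConv (H →ₐ[ℂ] Laurent[X])).ofConv
  set F := (f L₀).1 with hF
  have hgp : toConv gp.toLinearMap = toConv gm.toLinearMap * toConv E.toLinearMap := rfl
  have hgp' : ∀ c, evalChr c gp = evalChr c gm * evalChr c E := fun c => by
    apply Chr.lin_injective
    rw [Chr.lin_mul, lin_evalChr, lin_evalChr, lin_evalChr, hgp, map_mul]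
  have hB : ∀ c, IsBirkhoff (evalChr c E) (evalChr c gm) (evalChr c gp) := fun c =>
    ⟨by rw [hgp']; group, fun x hx => evalFam_mem (hpolar x hx) c, fun x => evalFam_mem (hholo x) c⟩
  -- The exponential commutes with `L₀`, which is why both factors give the same orbit.
  have hEcomm : ∀ c, Ad (evalChr c E) L₀ = L₀ := fun c =>
    Ad_eq_self_iff.2 (commute_evalChr hE c (hf.commute 𝓗 L₀).symm.neg_left)
  have hAd : ∀ c, Ad (evalChr c gp) L₀ = Ad (evalChr c gm) L₀ := fun c => by
    rw [hgp', Ad_mul, hEcomm]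
  refine ⟨fun t => Ad (evalChr t gp) L₀, ⟨?_, fun t x n => ?_⟩, fun t => ?_⟩
  · have h1 := (hB 0).negPart_eq
    have h2 : IsBirkhoff (1 : Chr H) 1 1 :=
      ⟨by group, fun x hx n _ => by
        change ((1 : WithConv (H →ₗ[ℂ] Laurent)) x).coeff n = 0
        rw [LinearMap.convOne_apply, hx, map_zero, Laurent.coeff_zero],
        fun x => isHolo_algebraMap _⟩
    rw [hE0, h2.negPart_eq] at h1
    change Ad (evalChr ((0 : ℝ) : ℂ) gp) L₀ = L₀
    rw [Complex.ofReal_zero, hAd, ← h1, Ad_one]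
  · refine (hasDerivAt_Ad_evalChr gp L₀ t x n).congr_deriv ?_
    set a' := postHom (evalFam (t : ℂ)) (convDeriv (toConv gm.toLinearMap)) with ha'
    set b' := postHom (evalFam (t : ℂ)) (convDeriv (toConv gp.toLinearMap)) with hb'
    have hgm1 : ∀ x, counit (R := ℂ) x = 0 → IsPolar (evalChr (t : ℂ) gm x) := (hB t).polar
    -- Differentiating `g₊ = g₋ ⋆ e` gives `g₊' = g₋' ⋆ e - g₊ ⋆ f(L₀)`. Multiply by `g₊⁻¹` on the
    -- right and use `f(L) = Ad(g₊) f(L₀)`.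
    have hfL : (f (Ad (evalChr (t : ℂ) gp) L₀)).1 =
        a' * (evalChr (t : ℂ) gm)⁻¹.lin - b' * (evalChr (t : ℂ) gp)⁻¹.lin := by
      have e1 : b' = a' * (evalChr (t : ℂ) E).lin -
          (evalChr (t : ℂ) gm).lin * (evalChr (t : ℂ) E).lin * F := by
        have hn : (-f L₀ : InfChar H Laurent).1 = -F := rfl
        rw [hb', hgp, convDeriv_mul, hEder, map_add, map_mul, map_mul, map_mul,
          postHom_evalFam_constFam, ← lin_evalChr, ← lin_evalChr, ← mul_assoc, hn, mul_neg,
          ← sub_eq_add_neg]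
      have e2 : (evalChr (t : ℂ) E).lin * (evalChr (t : ℂ) gp)⁻¹.lin =
          (evalChr (t : ℂ) gm)⁻¹.lin := by
        rw [← Chr.lin_mul, hgp', mul_inv_rev, mul_inv_cancel_left]
      rw [← hf, Ad_val, e1, sub_mul, mul_assoc a', e2, sub_sub_cancel, hgp', Chr.lin_mul]
    have hpol : ∀ y, IsPolar ((a' * (evalChr (t : ℂ) gm)⁻¹.lin) y) := by
      -- The part of `g₋` that is not polar is the constant `ε`, which has zero derivative in `t`.
      have ha : ∀ y, a' y ∈ polarPart := fun y => by
        have e : gm y = gm (y - algebraMap ℂ H (counit (R := ℂ) y)) +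
            algebraMap ℂ Laurent[X] (counit (R := ℂ) y) := by
          rw [map_sub, AlgHom.commutes, sub_add_cancel]
        have e' : derivative (gm y) =
            derivative (gm (y - algebraMap ℂ H (counit (R := ℂ) y))) := by
          rw [e, derivative_add]
          refine (congrArg _ ?_).trans (add_zero _)
          exact derivative_C
        change evalFam t (derivative (gm y)) ∈ polarPart
        rw [e']
        exact evalFam_mem (derivative_mem_famSubmodule (hpolar _ (by simp))) _
      have hi := Chr.IsPolar.inv (g := evalChr (t : ℂ) gm) hgm1
      intro y
      have e : a' * (evalChr (t : ℂ) gm)⁻¹.lin =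
          a' * ((evalChr (t : ℂ) gm)⁻¹.lin - 1) + a' := by noncomm_ring
      rw [e]
      exact polarPart.add_mem (convMul_mem_of_forall polarPart
        (fun u v => IsPolar.mul (ha u) (hi.sub_one v)) y) (ha y)
    have hhol : ∀ y, IsHolo ((b' * (evalChr (t : ℂ) gp)⁻¹.lin) y) := by
      have hb : ∀ y, b' y ∈ holoPart := fun y =>
        evalFam_mem (derivative_mem_famSubmodule (hholo y)) _
      exact convMul_mem_of_forall holoPart
        fun u v => IsHolo.mul (hb u) (Chr.isHolo_inv (hB t).holo v)
    -- `f(L)` is now split into a polar and a holomorphic part, so `P₊` reads off the latter and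
    -- `[L, P₊ f(L)] = [g₊' ⋆ g₊⁻¹, L]`.
    have hP : (InfChar.map Pplus (f (Ad (evalChr (t : ℂ) gp) L₀))).1 =
        -(b' * (evalChr (t : ℂ) gp)⁻¹.lin) := by
      refine WithConv.ext (LinearMap.ext fun y => ?_)
      rw [map_Pplus_apply, hfL, ofConv_sub, LinearMap.sub_apply, map_sub,
        (hpol y).Pplus_eq_zero, (hhol y).Pplus_eq_self, zero_sub]
      rfl
    rw [hf.lie_laxM 𝓗, lie_val, hP, mul_neg, neg_mul, sub_neg_eq_add, neg_add_eq_sub]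
  · refine ⟨evalChr t E, evalChr t gm, evalChr t gp, ?_, hB t, rfl, hAd t⟩
    rw [neg_smul, ← smul_neg]
    exact isExp_evalChr hE t

end LaxFlow

end LaxBeta

end

/-! ### The theorem. -/

theorem theorem7p10 {H : Type*} [CommRing H] [HopfAlgebra ℂ H]
    (𝓗 : ℕ → Submodule ℂ H) [GradedAlgebra 𝓗] [LaxBeta.IsConnectedGraded 𝓗]
    (φ : LaxBeta.Chr H) (hφ : LaxBeta.IsLocal 𝓗 φ)
    (f : LaxBeta.InfChar H LaxBeta.Laurent → LaxBeta.InfChar H LaxBeta.Laurent)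
    (hf : LaxBeta.AdCovariant f)
    (hcomm : ⁅f (LaxBeta.InfChar.const (LaxBeta.betaFun 𝓗 φ)), (LaxBeta.InfChar.const (LaxBeta.betaFun 𝓗 φ))⁆ = 0) :
    (∃ L : ℝ → LaxBeta.InfChar H LaxBeta.Laurent,
      LaxBeta.IsLaxSolution f (LaxBeta.InfChar.const (LaxBeta.betaFun 𝓗 φ)) L ∧
      LaxBeta.IsFactorizationFlow f (LaxBeta.InfChar.const (LaxBeta.betaFun 𝓗 φ)) L) ∧
    ∀ L : ℝ → LaxBeta.InfChar H LaxBeta.Laurent,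
      LaxBeta.IsLaxSolution f (LaxBeta.InfChar.const (LaxBeta.betaFun 𝓗 φ)) L →
      (∀ t x, LaxBeta.IsHolo ((L t).1 x)) ∧
      ∃ ξ : ℝ → LaxBeta.Chr H,
        (∀ t ζ, LaxBeta.lamRtilde 𝓗 ζ = LaxBeta.InfChar.const (LaxBeta.InfChar.evalZero (L t)) ↔ ζ = ξ t) ∧
        (∀ t, LaxBeta.IsLocal 𝓗 (ξ t)) ∧
        (∀ t, LaxBeta.betaFun 𝓗 (ξ t) = LaxBeta.InfChar.evalZero (L t)) ∧
        ξ 0 = (LaxBeta.negPart φ)⁻¹ := by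
  refine ⟨hf.exists_laxSolution 𝓗 _, fun L hL => ⟨fun t x =>
    hL.isHolo 𝓗 hf (fun y => LaxBeta.isHolo_algebraMap _) t x, ?_⟩⟩
  choose ξ hξ using fun t : ℝ => LaxBeta.exists_lamRtilde_eq 𝓗
    (LaxBeta.InfChar.const (LaxBeta.InfChar.evalZero (L t)))
  refine ⟨ξ, fun t ζ => ⟨fun h => LaxBeta.lamRtilde_injective (𝓗 := 𝓗) (h.trans (hξ t).symm),
    fun h => h ▸ hξ t⟩, fun t => LaxBeta.isLocal_of_lamRtilde_eq_const (hξ t),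
    fun t => LaxBeta.betaFun_eq_of_lamRtilde_eq_const (hξ t), ?_⟩
  -- By the scattering formula both sides have `λR̃` equal to the constant `β_φ`.
  apply LaxBeta.lamRtilde_injective (𝓗 := 𝓗)
  rw [hξ, hφ.lamRtilde_inv_negPart, hL.init]
  refine Subtype.ext (WithConv.ext (LinearMap.ext fun x => ?_))
  rw [LaxBeta.const_apply, LaxBeta.const_apply]
  congr 1
  exact (LaxBeta.Laurent.coeff_algebraMap _ 0).trans (if_pos rfl)
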